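/- Let $x_1,\dots,x_n\in\mathbb{R}^d$ ($n\ge 1$) and $y_1,\dots,y_n\in\mathbb{R}$ be training data with $\|x_i\|_2\le K$ and $|y_i|\le K$ for all $i$. For $W=(w_1,\dots,w_m)$ with $w_r\in\mathbb{R}^d$ and $a\in\mathbb{R}^m$ let $$f(W,a,x)=\frac1{\sqrt m}\sum_{r=1}^m a_r\max\{w_r^\top x,0\},\qquad L(W,a)=\frac12\sum_{i=1}^n\big(f(W,a,x_i)-y_i\big)^2 .$$ Let $H^\infty\in\mathbb{R}^{n\times n}$ be the matrix with entries $H^\infty_{ij}=\mathbb{E}_{w\sim\mathcal N(0,I_d)}\big[x_i^\top x_j\,\mathbb{1}\{w^\top x_i\ge 0,\ w^\top x_j\ge 0\}\big]$, and put $\lambda_0=\lambda_{\min}(H^\infty)$ and $\lambda_m=\lambda_{\max}(H^\infty)+\lambda_0/4$. There is a constant $C>0$, depending only on $K$, such that the following holds for all such data (with arbitrary $n$ and $d$), all $\delta\in(0,1)$, all widths $m$ with $m\,\delta^3\lambda_0^4\ge C\,n^6$ (in particular $\lambda_0>0$, and then the condition reads $m\ge C n^6/(\delta^3\lambda_0^4)$),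 and all $0<s\le 2/\lambda_m$. Let $w_1(0),\dots,w_m(0)\sim\mathcal N(0,I_d)$ and $a_1,\dots,a_m$ uniform on $\{-1,1\}$ be independent, and let only the first layer be trained, by the high-resolution heavy-ball ODE $$\ddot w_r(t)+\sqrt{2\lambda_0}\,\dot w_r(t)+\Big(1+\sqrt{\tfrac{\lambda_0 s}{2}}\Big)\frac{\partial L(W(t),a)}{\partial w_r}=0,\qquad \dot w_r(0)=0,\qquad r=1,\dots,m,$$ where $$\frac{\partial L}{\partial w_r}=\sum_{i=1}^n\big(f(W,a,x_i)-y_i\big)\frac{a_r}{\sqrt m}\,\mathbb{1}\{w_r^\top x_i\ge 0\}\,x_i .$$ As this gradient is discontinuous in $W$, a solution is a continuously differentiable path on $[0,\infty)$ with locally absolutely continuous velocity that satisfies the equation for almost every $t$; at times with $w_r(t)^\top x_i=0$ the indicator may be replaced by any value in $[0,1]$, chosen measurably in $t$. Then, with probability at least $1-\delta$ over the initialization $(W(0),a)$, every solution satisfies, for all $t\ge 0$, $$L(W(t),a)\le\frac{6\,\hat L(0)}{\lambda_0}\,\exp\Big(-(2-\sqrt2)\sqrt{\tfrac{\lambda_0}{2}}\;t\Big),$$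 where $\hat L(0)=\tfrac12\Delta^\top H\Delta$ with $\Delta_i=f(W(0),a,x_i)-y_i$ and $H_{ij}=\sum_{r=1}^m\big\langle\frac{\partial f_i}{\partial w_r},\frac{\partial f_j}{\partial w_r}\big\rangle$ at $W(0)$, $\frac{\partial f_i}{\partial w_r}=\frac{a_r}{\sqrt m}\mathbb{1}\{w_r(0)^\top x_i\ge0\}\,x_i$. -/

import Mathlib

open MeasureTheory ProbabilityTheory Set

/-- The input space `ℝ^d` with the Euclidean norm. -/
abbrev Vec (d : ℕ) : Type := EuclideanSpace ℝ (Fin d)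

/-- The ReLU activation `z ↦ max {z, 0}`. -/
noncomputable def relu (z : ℝ) : ℝ := max z 0

/-- The derivative `𝟙{z ≥ 0}` of ReLU, with the convention that it is `1` at the kink. -/
noncomputable def reluDeriv (z : ℝ) : ℝ := if 0 ≤ z then 1 else 0

/-- The set of generalized (Clarke) derivatives of ReLU at `z`: `{1}` for `z > 0`, `{0}` for `z < 0`
and `[0, 1]` at the kink `z = 0`. It always contains `reluDeriv z`. -/
noncomputable def reluSlopes (z : ℝ) : Set ℝ :=
  if 0 < z then {1} else if z < 0 then {0} else Icc 0 1

/-- The two-layer network `f(W, a, x) = m^{-1/2} ∑_r a_r relu(⟨w_r, x⟩)`. -/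
noncomputable def network {d m : ℕ} (a : Fin m → ℝ) (w : Fin m → Vec d) (x : Vec d) : ℝ :=
  1 / Real.sqrt m * ∑ r, a r * relu (inner ℝ (w r) x)

/-- The residual vector `Δ_i = f(W, a, x_i) - y_i`. -/
noncomputable def netResidual {n d m : ℕ} (x : Fin n → Vec d) (y : Fin n → ℝ)
    (a : Fin m → ℝ) (w : Fin m → Vec d) (i : Fin n) : ℝ :=
  network a w (x i) - y i

/-- The training loss `L(W, a) = (1/2) ∑_i (f(W, a, x_i) - y_i)^2`. -/
noncomputable def loss {n d m : ℕ} (x : Fin n → Vec d) (y : Fin n → ℝ)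
    (a : Fin m → ℝ) (w : Fin m → Vec d) : ℝ :=
  1 / 2 * ∑ i, netResidual x y a w i ^ 2

/-- The vector `m^{-1/2} a_r θ x_i`. For `θ = 𝟙{⟨w_r, x_i⟩ ≥ 0}` it is `∂f_i / ∂w_r`. -/
noncomputable def outputGrad {n d m : ℕ} (x : Fin n → Vec d) (a : Fin m → ℝ)
    (θ : ℝ) (r : Fin m) (i : Fin n) : Vec d :=
  (1 / Real.sqrt m * a r * θ) • x i

/-- The partial gradient `∂L / ∂w_r = ∑_i (f_i - y_i) ∂f_i / ∂w_r`, where `θ r i` is the value used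
for the derivative of ReLU at `⟨w_r, x_i⟩`. -/
noncomputable def lossGrad {n d m : ℕ} (x : Fin n → Vec d) (y : Fin n → ℝ)
    (a : Fin m → ℝ) (w : Fin m → Vec d) (θ : Fin m → Fin n → ℝ) (r : Fin m) : Vec d :=
  ∑ i, netResidual x y a w i • outputGrad x a (θ r i) r i

/-- The Gram matrix `H = ∑_r (∂f / ∂w_r) (∂f / ∂w_r)ᵀ`. -/
noncomputable def gram {n d m : ℕ} (x : Fin n → Vec d) (a : Fin m → ℝ) (w : Fin m → Vec d) :
    Matrix (Fin n) (Fin n) ℝ :=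
  Matrix.of fun i j => ∑ r,
    inner ℝ (outputGrad x a (reluDeriv (inner ℝ (w r) (x i))) r i)
      (outputGrad x a (reluDeriv (inner ℝ (w r) (x j))) r j)

/-- The pseudo-loss `(1/2) Δᵀ H Δ`. -/
noncomputable def pseudoLoss {n d m : ℕ} (x : Fin n → Vec d) (y : Fin n → ℝ)
    (a : Fin m → ℝ) (w : Fin m → Vec d) : ℝ :=
  1 / 2 * (netResidual x y a w ⬝ᵥ (gram x a w).mulVec (netResidual x y a w))

/-- The limiting kernel matrix
`H^∞_{ij} = E_{w ∼ N(0, I)} [⟨x_i, x_j⟩ 𝟙{⟨w, x_i⟩ ≥ 0, ⟨w, x_j⟩ ≥ 0}]`. -/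
noncomputable def ntk {n d : ℕ} (x : Fin n → Vec d) : Matrix (Fin n) (Fin n) ℝ :=
  Matrix.of fun i j => ∫ w : Vec d,
    inner ℝ (x i) (x j) * (reluDeriv (inner ℝ w (x i)) * reluDeriv (inner ℝ w (x j)))
      ∂(stdGaussian (Vec d))

/-- `λ₀`, the smallest eigenvalue of the symmetric matrix `H^∞`. -/
noncomputable def lambdaZero {n d : ℕ} (x : Fin n → Vec d) : ℝ := sInf (spectrum ℝ (ntk x))

/-- `λ_m`, the largest eigenvalue of `H^∞` plus `λ₀ / 4`. -/
noncomputable def lambdaM {n d : ℕ} (x : Fin n → Vec d) : ℝ :=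
  sSup (spectrum ℝ (ntk x)) + lambdaZero x / 4

/-- The uniform distribution on `{-1, 1}`. -/
noncomputable def rademacher : Measure ℝ :=
  (2⁻¹ : ENNReal) • Measure.dirac (-1) + (2⁻¹ : ENNReal) • Measure.dirac 1

/-- The law of the random initialization `(W(0), a)`: the `w_r(0)` are standard Gaussian vectors,
the `a_r` are Rademacher variables, and all of them are independent. -/
noncomputable def initLaw (d m : ℕ) : Measure ((Fin m → Vec d) × (Fin m → ℝ)) :=
  (Measure.pi fun _ => stdGaussian (Vec d)).prod (Measure.pi fun _ => rademacher)

/-- `w : [0, ∞) → (ℝ^d)^m` is a solution of the heavy-ball ODE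
`w_r'' + 2 √α w_r' + (1 + √(α s)) ∂L/∂w_r = 0` for all `r`, started at `w₀` with velocity zero.

As `∂L/∂w_r` is discontinuous in `w`, the equation is understood in integrated form: `w` is
continuously differentiable with velocity `v`, and `v` is the integral of the right-hand side, so
that it is locally absolutely continuous and the ODE holds at almost every time. At the times where
`⟨w_r, x_i⟩ = 0` the derivative of ReLU may take any value in `[0, 1]`, chosen measurably in time
(`θ`), i.e. Filippov solutions are included; `θ t r i = 𝟙{⟨w_r(t), x_i⟩ ≥ 0}` is one such choice. -/
structure IsHeavyBallSolution {n d m : ℕ} (x : Fin n → Vec d) (y : Fin n → ℝ) (a : Fin m → ℝ)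
    (α s : ℝ) (w₀ : Fin m → Vec d) (w v : ℝ → Fin m → Vec d)
    (θ : ℝ → Fin m → Fin n → ℝ) : Prop where
  init : w 0 = w₀
  init_velocity : v 0 = 0
  velocity : ∀ t, 0 ≤ t → ∀ r, HasDerivWithinAt (fun u => w u r) (v t r) (Ici 0) t
  velocity_continuous : ∀ r, ContinuousOn (fun u => v u r) (Ici 0)
  slope_measurable : ∀ r i, Measurable fun t => θ t r i
  slope_mem : ∀ t, 0 ≤ t → ∀ r i, θ t r i ∈ reluSlopes (inner ℝ (w t r) (x i))
  ode : ∀ t, 0 ≤ t → ∀ r, v t r = ∫ u in (0 : ℝ)..t,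
    (-(2 * Real.sqrt α) • v u r - (1 + Real.sqrt (α * s)) • lossGrad x y a (w u) (θ u) r)

/-!
Write `Δ ∈ ℝⁿ` for the residual, `v` for the velocity, `J(t)` for the Jacobian of the outputs in the
weights (with the slopes `θ` of the solution), `σ = √(λ₀ / 2)` and `c = 1 + √(λ₀ s / 2) ∈ [1, 2]`. By the
chain rule `deriv_relu_comp_eq_slope_mul`, which holds at almost every time whatever the slopes at the
kinks are, the ODE becomes the first-order system

  `Δ' = J v`,  `v' = -2 σ v - c Jᵀ Δ`.

The Jacobian is only measurable in time, so it cannot be differentiated once more. Instead, let `J₀`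
be the Jacobian at initialization and `M = J₀ᵀ (J₀ J₀ᵀ)⁻¹`, and consider the energy

  `E = c ‖Δ‖² + ‖v‖² + σ ⟨v, M Δ⟩`.

If `J₀ J₀ᵀ ≥ (3 / 4) λ₀` and `‖J - J₀‖` is at most a tenth of `√((3 / 4) λ₀)`, then
`E' ≤ -(2 - √2) σ E` almost everywhere (`energy_dissipation`). All quantities are Lipschitz on compact
time intervals, so this integrates to exponential decay of `‖Δ‖` (`oscillator_decay`). Using `M` rather
than `J₀ᵀ` in the cross term makes only the relative size of `J - J₀` matter.

The Jacobian changes only through neurons whose activation pattern changes, and while the weights move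
by at most `R` these are among the neurons with `|⟨w_r(0), x_i⟩| ≤ R ‖x_i‖` (`kinkMass`). Conversely the
decay of `Δ` bounds the displacement of each weight by `8 K √(n / m) ‖Δ(0)‖ / λ₀`
(`IsHeavyBallSolution.norm_displacement_le`). If this is less than `R`, no weight ever reaches distance
`R`, which closes the argument (`IsHeavyBallSolution.residual_decay_of_radius`).

Three properties of the initialization are needed: the Gram matrix is within `λ₀ / 4` of `H^∞`,
`kinkMass` is small, and `Δ(0)` is of order `√(n / δ)`. The expectations involved are computed from
the variance of sums of independent variables and from the bound `P(|⟨w, ξ⟩| ≤ R ‖ξ‖) ≤ R` for Gaussian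
`w`, and Markov's inequality then suffices (`initLaw_good_event`).
-/

/-! ### Calculus along absolutely continuous paths -/

theorem reluSlopes_subset_Icc (z : ℝ) : reluSlopes z ⊆ Icc 0 1 := by
  intro θ hθ
  unfold reluSlopes at hθ
  split_ifs at hθ <;> simp_all

theorem lipschitzWith_relu : LipschitzWith 1 relu := by
  have : relu = fun z => max z 0 := rfl
  rw [this]
  exact LipschitzWith.id.max_const 0

/-- The Clarke chain rule for ReLU: wherever `relu ∘ g` happens to be differentiable, every
generalized slope computes its derivative. At a zero of `g` both `relu ∘ g` and
`relu ∘ g - g = relu ∘ (-g)` are minimal, so differentiability forces `g' = 0` and `D = 0`. -/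
theorem deriv_relu_comp_eq_slope_mul {g : ℝ → ℝ} {g' D t θ : ℝ} (hg : HasDerivAt g g' t)
    (hD : HasDerivAt (fun u => relu (g u)) D t) (hθ : θ ∈ reluSlopes (g t)) : D = θ * g' := by
  rcases lt_trichotomy (g t) 0 with h | h | h
  · have hθ0 : θ = 0 := by simpa [reluSlopes, h, h.le.not_gt] using hθ
    have hev : (fun u => relu (g u)) =ᶠ[nhds t] fun _ => 0 := by
      filter_upwards [hg.continuousAt.eventually (gt_mem_nhds h)] with u hu
      exact max_eq_right hu.le
    rw [hθ0, zero_mul]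
    exact hD.unique ((hasDerivAt_const t (0 : ℝ)).congr_of_eventuallyEq hev)
  · have hmin : ∀ u, relu (g t) ≤ relu (g u) := fun u => by
      simp [relu, h]
    have h1 : D = 0 :=
      IsLocalMin.hasDerivAt_eq_zero (Filter.Eventually.of_forall hmin) hD
    have hmin' : ∀ u, relu (g t) - g t ≤ relu (g u) - g u := fun u => by
      simp [relu, h]
    have h2 : D - g' = 0 :=
      IsLocalMin.hasDerivAt_eq_zero (f := fun u => relu (g u) - g u)
        (Filter.Eventually.of_forall hmin') (hD.sub hg)
    have h3 : g' = 0 := by linarith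
    rw [h1, h3, mul_zero]
  · have hθ1 : θ = 1 := by simpa [reluSlopes, h] using hθ
    have hev : (fun u => relu (g u)) =ᶠ[nhds t] g := by
      filter_upwards [hg.continuousAt.eventually (lt_mem_nhds h)] with u hu
      exact max_eq_left hu.le
    rw [hθ1, one_mul]
    exact hD.unique (hg.congr_of_eventuallyEq hev)

theorem AbsolutelyContinuousOnInterval.le_of_ae_deriv_nonpos {f : ℝ → ℝ} {a b : ℝ} (hab : a ≤ b)
    (hf : AbsolutelyContinuousOnInterval f a b)
    (h : ∀ᵐ t, t ∈ Ioo a b → ∃ f', HasDerivAt f f' t ∧ f' ≤ 0) : f b ≤ f a := by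
  have h1 := hf.integral_deriv_eq_sub
  rw [intervalIntegral.integral_of_le hab, integral_Ioc_eq_integral_Ioo] at h1
  have h2 : ∫ t in Ioo a b, deriv f t ≤ 0 := by
    refine setIntegral_nonpos_ae measurableSet_Ioo ?_
    filter_upwards [h] with t ht hmem
    obtain ⟨f', hd, hle⟩ := ht hmem
    rwa [hd.deriv]
  linarith

/-! ### The Lyapunov estimate -/

section Lyapunov

variable {V Y : Type*} [NormedAddCommGroup V] [InnerProductSpace ℝ V]
  [NormedAddCommGroup Y] [InnerProductSpace ℝ Y]

/-- A surjective `J` with transpose `Jt` and `J Jᵀ ≥ μ` has the right inverse `Jᵀ (J Jᵀ)⁻¹`. Its norm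
is at most `μ ^ (-1/2)`, and composed with `J` it is an orthogonal projection. -/
theorem exists_rightInverse_of_transpose_bounded_below [FiniteDimensional ℝ Y]
    (J : V →ₗ[ℝ] Y) (Jt : Y →ₗ[ℝ] V)
    (hadj : ∀ y u, inner ℝ (Jt y) u = inner ℝ y (J u)) {μ : ℝ} (hμ : 0 < μ)
    (hlow : ∀ y, μ * ‖y‖ ^ 2 ≤ ‖Jt y‖ ^ 2) :
    ∃ M : Y →L[ℝ] V, (∀ y, J (M y) = y) ∧ (∀ y, μ * ‖M y‖ ^ 2 ≤ ‖y‖ ^ 2) ∧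
      ∀ u, inner ℝ u (M (J u)) ≤ ‖u‖ ^ 2 := by
  set H : Y →ₗ[ℝ] Y := J ∘ₗ Jt with hH
  have hHq : ∀ z, inner ℝ z (H z) = ‖Jt z‖ ^ 2 := fun z => by
    rw [hH, LinearMap.comp_apply, ← hadj, real_inner_self_eq_norm_sq]
  have hinj : Function.Injective H := by
    rw [injective_iff_map_eq_zero]
    intro z hz
    have h1 := hlow z
    rw [← hHq, hz, inner_zero_right] at h1
    have h2 : ‖z‖ ^ 2 ≤ 0 := by nlinarith [sq_nonneg ‖z‖]
    have h3 : ‖z‖ = 0 := by nlinarith [norm_nonneg z]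
    exact norm_eq_zero.mp h3
  let e : Y ≃ₗ[ℝ] Y := LinearEquiv.ofInjectiveEndo H hinj
  have he : ∀ y, H (e.symm y) = y := fun y => e.apply_symm_apply y
  have hM : ∀ y, J (Jt (e.symm y)) = y := he
  refine ⟨LinearMap.toContinuousLinearMap (Jt ∘ₗ e.symm.toLinearMap), ?_, ?_, ?_⟩
  · intro y
    exact hM y
  · intro y
    change μ * ‖Jt (e.symm y)‖ ^ 2 ≤ ‖y‖ ^ 2
    set z := e.symm y with hz
    have h1 : ‖Jt z‖ ^ 2 ≤ ‖z‖ * ‖y‖ := by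
      rw [← hHq, hz, he]
      exact real_inner_le_norm _ _
    have h2 := hlow z
    have h3 : (μ * ‖Jt z‖ ^ 2) * ‖Jt z‖ ^ 2 ≤ ‖y‖ ^ 2 * ‖Jt z‖ ^ 2 := by
      have : (‖Jt z‖ ^ 2) ^ 2 ≤ (‖z‖ * ‖y‖) ^ 2 := by gcongr
      nlinarith [mul_le_mul_of_nonneg_right h2 (sq_nonneg ‖y‖)]
    rcases (sq_nonneg ‖Jt z‖).eq_or_lt with h0 | h0
    · rw [← h0]; simp
    · exact le_of_mul_le_mul_right h3 h0
  · intro u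
    change inner ℝ u (Jt (e.symm (J u))) ≤ ‖u‖ ^ 2
    set z := Jt (e.symm (J u)) with hz
    have h1 : inner ℝ u z = ‖z‖ ^ 2 := by
      rw [real_inner_comm, ← real_inner_self_eq_norm_sq, hz, hadj, hadj, hM]
    have h2 := real_inner_le_norm u z
    rw [h1] at h2 ⊢
    have h3 : ‖z‖ ≤ ‖u‖ := by
      by_contra! hlt
      nlinarith [norm_nonneg u]
    gcongr

theorem two_sub_sqrt_two_bounds : 29 / 50 < 2 - √2 ∧ 2 - √2 < 59 / 100 := by
  have h1 : √2 < 142 / 100 := by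
    rw [Real.sqrt_lt' (by norm_num)]; norm_num
  have h2 : 141 / 100 < √2 := by
    apply Real.lt_sqrt_of_sq_lt; norm_num
  constructor <;> linarith

theorem abs_cross_term_le {M : Y →L[ℝ] V} {σ : ℝ} (hσ : 0 < σ)
    (hMσ : ∀ y, σ * ‖M y‖ ≤ 5 / 6 * ‖y‖) (v : V) (Δ : Y) :
    |σ * inner ℝ v (M Δ)| ≤ 5 / 6 * (‖v‖ * ‖Δ‖) := by
  rw [abs_mul, abs_of_pos hσ]
  calc σ * |inner ℝ v (M Δ)| ≤ σ * (‖v‖ * ‖M Δ‖) := by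
        gcongr; exact abs_real_inner_le_norm _ _
    _ = ‖v‖ * (σ * ‖M Δ‖) := by ring
    _ ≤ ‖v‖ * (5 / 6 * ‖Δ‖) := mul_le_mul_of_nonneg_left (hMσ Δ) (norm_nonneg v)
    _ = _ := by ring

/-- The energy `c ‖Δ‖² + ‖v‖² + σ ⟨v, M Δ⟩` of a linear oscillator `Δ' = J v`,
`v' = -2 σ v - c Jᵀ Δ` dissipates at rate at least `(2 - √2) σ`, for every `J` close to a fixed map `J₀`
with right inverse `M`. Here `g = Jᵀ Δ`. The bounds on `M` hold for the right inverse of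
`exists_rightInverse_of_transpose_bounded_below` with `μ = 3 / 2 σ²` and `ε² = μ / 100`. They make
the energy comparable to `‖Δ‖² + ‖v‖²`, and replacing `J` by `J₀` changes the derivative of the cross
term by at most `σ (‖v‖² + c ‖Δ‖²) / 10`. -/
theorem energy_dissipation {J J₀ : V →ₗ[ℝ] Y} {M : Y →L[ℝ] V} {σ c ε : ℝ} (hσ : 0 < σ) (hc : 1 ≤ c)
    (hε : 0 < ε) (hinv : ∀ y, J₀ (M y) = y) (hproj : ∀ u, inner ℝ u (M (J₀ u)) ≤ ‖u‖ ^ 2)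
    (hMε : ∀ y, ε * ‖M y‖ ≤ ‖y‖ / 10) (hMσ : ∀ y, σ * ‖M y‖ ≤ 5 / 6 * ‖y‖)
    (hJ : ∀ u, ‖J u - J₀ u‖ ≤ ε * ‖u‖) {Δ : Y} {v g : V}
    (hg : ∀ u, inner ℝ g u = inner ℝ Δ (J u)) :
    2 * c * inner ℝ Δ (J v) + 2 * inner ℝ v (-(2 * σ) • v - c • g) +
        σ * (inner ℝ v (M (J v)) + inner ℝ (-(2 * σ) • v - c • g) (M Δ)) ≤
      -((2 - √2) * σ) * (c * ‖Δ‖ ^ 2 + ‖v‖ ^ 2 + σ * inner ℝ v (M Δ)) := by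
  obtain ⟨hρ1, hρ2⟩ := two_sub_sqrt_two_bounds
  set ρ := 2 - √2
  have hX := norm_nonneg v
  have hY := norm_nonneg Δ
  have e1 : inner ℝ v (-(2 * σ) • v - c • g) = -(2 * σ) * ‖v‖ ^ 2 - c * inner ℝ Δ (J v) := by
    rw [inner_sub_right, inner_smul_right, inner_smul_right, real_inner_self_eq_norm_sq,
      real_inner_comm, hg]
  have e2 : inner ℝ (-(2 * σ) • v - c • g) (M Δ) =
      -(2 * σ) * inner ℝ v (M Δ) - c * inner ℝ Δ (J (M Δ)) := by
    rw [inner_sub_left, real_inner_smul_left, real_inner_smul_left, hg]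
  have b1 : 9 / 10 * ‖Δ‖ ^ 2 ≤ inner ℝ Δ (J (M Δ)) := by
    have h1 : inner ℝ Δ (J (M Δ)) = ‖Δ‖ ^ 2 + inner ℝ Δ (J (M Δ) - J₀ (M Δ)) := by
      rw [inner_sub_right, hinv, real_inner_self_eq_norm_sq]; ring
    have h2 : |inner ℝ Δ (J (M Δ) - J₀ (M Δ))| ≤ ‖Δ‖ * (‖Δ‖ / 10) :=
      (abs_real_inner_le_norm _ _).trans
        (mul_le_mul_of_nonneg_left ((hJ _).trans (hMε Δ)) hY)
    have h3 := (abs_le.mp h2).1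
    rw [h1]; nlinarith
  have b2 : inner ℝ v (M (J v)) ≤ 11 / 10 * ‖v‖ ^ 2 := by
    have h1 : inner ℝ v (M (J v)) = inner ℝ v (M (J₀ v)) + inner ℝ v (M (J v - J₀ v)) := by
      rw [map_sub, inner_sub_right]; ring
    have h2 : ‖M (J v - J₀ v)‖ ≤ ‖v‖ / 10 := by
      have := (hMε (J v - J₀ v)).trans (div_le_div_of_nonneg_right (hJ v) (by norm_num))
      have h : ε * ‖M (J v - J₀ v)‖ ≤ ε * (‖v‖ / 10) := by linarith
      exact le_of_mul_le_mul_left h hε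
    have h3 := (real_inner_le_norm v (M (J v - J₀ v))).trans (mul_le_mul_of_nonneg_left h2 hX)
    have := hproj v
    rw [h1]; nlinarith
  have b3 := abs_cross_term_le hσ hMσ v Δ
  rw [e1, e2]
  set q := σ * inner ℝ v (M Δ) with hq
  set p := inner ℝ Δ (J v)
  set X := ‖v‖
  set Z := ‖Δ‖
  have key : -4 * X ^ 2 - 2 * q - c * (9 / 10 * Z ^ 2) + 11 / 10 * X ^ 2 +
      ρ * (c * Z ^ 2 + X ^ 2 + q) ≤ 0 := by
    obtain ⟨q1, q2⟩ := abs_le.mp b3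
    have hXZ : 0 ≤ X * Z := mul_nonneg hX hY
    have t1 : -(2 - ρ) * q ≤ 71 / 50 * (5 / 6 * (X * Z)) := by nlinarith
    have t2 : (31 / 100) * Z ^ 2 ≤ (9 / 10 - ρ) * (c * Z ^ 2) := by
      have hZ : Z ^ 2 ≤ c * Z ^ 2 := le_mul_of_one_le_left (sq_nonneg Z) hc
      nlinarith [sq_nonneg Z]
    have t3 : (231 / 100) * X ^ 2 ≤ (29 / 10 - ρ) * X ^ 2 := by nlinarith [sq_nonneg X]
    nlinarith [sq_nonneg (2 * X - 71 / 120 * Z), sq_nonneg X, sq_nonneg Z]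
  have b1' : c * (9 / 10 * Z ^ 2) ≤ c * inner ℝ Δ (J (M Δ)) := by gcongr
  have e3 : 2 * c * p + 2 * (-(2 * σ) * X ^ 2 - c * p) +
      σ * (inner ℝ v (M (J v)) + (-(2 * σ) * inner ℝ v (M Δ) - c * inner ℝ Δ (J (M Δ)))) =
      σ * (-4 * X ^ 2 + inner ℝ v (M (J v)) - 2 * q - c * inner ℝ Δ (J (M Δ))) := by
    rw [hq]; ring
  rw [e3]
  have e4 : σ * (-4 * X ^ 2 + inner ℝ v (M (J v)) - 2 * q - c * inner ℝ Δ (J (M Δ))) ≤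
      σ * (-(ρ * (c * Z ^ 2 + X ^ 2 + q))) := by
    refine mul_le_mul_of_nonneg_left ?_ hσ.le
    linarith
  linarith

theorem absolutelyContinuousOnInterval_comp_of_contDiff {X : Type*} [NormedAddCommGroup X]
    [NormedSpace ℝ X] {Φ : X → ℝ} (hΦ : ContDiff ℝ 1 Φ) {z : ℝ → X} {a b : ℝ} {C : NNReal}
    (hz : LipschitzOnWith C z (uIcc a b)) :
    AbsolutelyContinuousOnInterval (fun t => Φ (z t)) a b := by
  obtain ⟨C', hC'⟩ := hΦ.locallyLipschitz.locallyLipschitzOn.exists_lipschitzOnWith_of_compact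
    (isCompact_uIcc.image_of_continuousOn hz.continuousOn)
  exact (hC'.comp hz (mapsTo_image z _)).absolutelyContinuousOnInterval

/-- Exponential decay of `Δ` for the oscillator `Δ' = J(t) v`, `v' = -2 σ v - c J(t)ᵀ Δ` started at
rest, as long as `J(t)` stays close to `J₀`. No regularity of `t ↦ J(t)` is needed because the cross
term of the energy involves only the constant map `M`. -/
theorem oscillator_decay {J₀ : V →ₗ[ℝ] Y} {M : Y →L[ℝ] V} {σ c ε : ℝ} (hσ : 0 < σ) (hc : 1 ≤ c)
    (hε : 0 < ε) (hinv : ∀ y, J₀ (M y) = y) (hproj : ∀ u, inner ℝ u (M (J₀ u)) ≤ ‖u‖ ^ 2)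
    (hMε : ∀ y, ε * ‖M y‖ ≤ ‖y‖ / 10) (hMσ : ∀ y, σ * ‖M y‖ ≤ 5 / 6 * ‖y‖)
    {T : ℝ} (hT : 0 ≤ T) {Δ : ℝ → Y} {v : ℝ → V} {C₁ C₂ : NNReal}
    (hΔ : LipschitzOnWith C₁ Δ (Icc 0 T)) (hv : LipschitzOnWith C₂ v (Icc 0 T)) (hv0 : v 0 = 0)
    (hode : ∀ᵐ t, t ∈ Ioo 0 T → ∃ (J : V →ₗ[ℝ] Y) (g : V), (∀ u, ‖J u - J₀ u‖ ≤ ε * ‖u‖) ∧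
      (∀ u, inner ℝ g u = inner ℝ (Δ t) (J u)) ∧ HasDerivAt Δ (J (v t)) t ∧
      HasDerivAt v (-(2 * σ) • v t - c • g) t) :
    ‖Δ T‖ ^ 2 ≤ 5 / 4 * ‖Δ 0‖ ^ 2 * Real.exp (-((2 - √2) * σ) * T) := by
  set κ := (2 - √2) * σ with hκ
  let E : ℝ → ℝ := fun t => c * ‖Δ t‖ ^ 2 + ‖v t‖ ^ 2 + σ * inner ℝ (v t) (M (Δ t))
  let Φ : ℝ × Y × V → ℝ := fun z =>
    (c * ‖z.2.1‖ ^ 2 + ‖z.2.2‖ ^ 2 + σ * inner ℝ z.2.2 (M z.2.1)) * Real.exp (κ * z.1)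
  have hΦ : ContDiff ℝ 1 Φ := by
    refine ContDiff.mul (((contDiff_const.mul ?_).add ?_).add (contDiff_const.mul ?_)) ?_
    · exact (contDiff_fst.comp contDiff_snd).norm_sq ℝ
    · exact (contDiff_snd.comp contDiff_snd).norm_sq ℝ
    · exact (contDiff_snd.comp contDiff_snd).inner ℝ
        (M.contDiff.comp (contDiff_fst.comp contDiff_snd))
    · exact (contDiff_const.mul contDiff_fst).exp
  have hac : AbsolutelyContinuousOnInterval (fun t => E t * Real.exp (κ * t)) 0 T := by
    have hz : LipschitzOnWith (max 1 (max C₁ C₂)) (fun t : ℝ => (t, Δ t, v t)) (uIcc 0 T) := by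
      rw [uIcc_of_le hT]
      exact LipschitzOnWith.prodMk (LipschitzWith.id.lipschitzOnWith) (hΔ.prodMk hv)
    have := absolutelyContinuousOnInterval_comp_of_contDiff hΦ hz
    exact this
  have hle : E T * Real.exp (κ * T) ≤ E 0 * Real.exp (κ * 0) := by
    refine hac.le_of_ae_deriv_nonpos hT ?_
    filter_upwards [hode] with t ht hmem
    obtain ⟨J, g, hJ, hg, hdΔ, hdv⟩ := ht hmem
    have hE : HasDerivAt E _ t :=
      ((hdΔ.norm_sq.const_mul c).add hdv.norm_sq).add
        ((hdv.inner ℝ (M.hasFDerivAt.comp_hasDerivAt t hdΔ)).const_mul σ)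
    have hexp : HasDerivAt (fun t => Real.exp (κ * t)) (Real.exp (κ * t) * κ) t := by
      simpa using ((hasDerivAt_id t).const_mul κ).exp
    refine ⟨_, hE.mul hexp, ?_⟩
    have := energy_dissipation hσ hc hε hinv hproj hMε hMσ hJ hg (v := v t)
    have hpos := Real.exp_pos (κ * t)
    simp only [Function.comp_apply]
    have h2 := mul_le_mul_of_nonneg_right this hpos.le
    simp only [E]
    linarith
  have hE0 : E 0 = c * ‖Δ 0‖ ^ 2 := by simp [E, hv0]
  -- Completing the square in `v` leaves `c - (5 / 12) ^ 2` as the coefficient of `‖Δ‖²`.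
  have hET : (c - 25 / 144) * ‖Δ T‖ ^ 2 ≤ E T := by
    have b3 := abs_cross_term_le hσ hMσ (v T) (Δ T)
    have := (abs_le.mp b3).1
    simp only [E]
    nlinarith [sq_nonneg (‖v T‖ - 5 / 12 * ‖Δ T‖)]
  rw [mul_zero, Real.exp_zero, mul_one, hE0] at hle
  have hmul : (c - 25 / 144) * ‖Δ T‖ ^ 2 * Real.exp (κ * T) ≤ c * ‖Δ 0‖ ^ 2 :=
    (mul_le_mul_of_nonneg_right hET (Real.exp_pos _).le).trans hle
  have hfin : ‖Δ T‖ ^ 2 * Real.exp (κ * T) ≤ 5 / 4 * ‖Δ 0‖ ^ 2 := by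
    have hA : 0 ≤ ‖Δ T‖ ^ 2 * Real.exp (κ * T) := by positivity
    have h5 : 4 / 5 * c ≤ c - 25 / 144 := by linarith
    have h6 : (4 / 5 * c) * (‖Δ T‖ ^ 2 * Real.exp (κ * T)) ≤ c * ‖Δ 0‖ ^ 2 := by
      have := mul_le_mul_of_nonneg_right h5 hA
      linarith
    have h7 : c * (4 / 5 * (‖Δ T‖ ^ 2 * Real.exp (κ * T))) ≤ c * ‖Δ 0‖ ^ 2 := by linarith
    have := le_of_mul_le_mul_left h7 (by linarith)
    linarith
  rw [neg_mul, Real.exp_neg]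
  exact (le_mul_inv_iff₀ (Real.exp_pos _)).mpr hfin

end Lyapunov

/-! ### The Jacobian of the network -/

/-- The space of first-layer weights with its Euclidean norm. -/
abbrev WeightSpace (d m : ℕ) : Type := PiLp 2 fun _ : Fin m => Vec d

/-- The Jacobian of the outputs `(f_1, …, f_n)` with respect to the first layer, with slopes `θ r i`
in place of the derivative of ReLU at `⟨w_r, x_i⟩`. -/
noncomputable def jacobian {n d m : ℕ} (x : Fin n → Vec d) (a : Fin m → ℝ)
    (θ : Fin m → Fin n → ℝ) : WeightSpace d m →ₗ[ℝ] EuclideanSpace ℝ (Fin n) where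
  toFun u := WithLp.toLp 2 fun i => ∑ r, inner ℝ (outputGrad x a (θ r i) r i) (u r)
  map_add' u u' := by
    ext i
    simp [inner_add_right, Finset.sum_add_distrib]
  map_smul' k u := by
    ext i
    simp [inner_smul_right, Finset.mul_sum]

/-- The transpose of `jacobian`. -/
noncomputable def jacobianTranspose {n d m : ℕ} (x : Fin n → Vec d) (a : Fin m → ℝ)
    (θ : Fin m → Fin n → ℝ) : EuclideanSpace ℝ (Fin n) →ₗ[ℝ] WeightSpace d m where
  toFun y := WithLp.toLp 2 fun r => ∑ i, y i • outputGrad x a (θ r i) r i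
  map_add' y y' := by
    ext r : 1
    simp [add_smul, Finset.sum_add_distrib]
  map_smul' k y := by
    ext r : 1
    simp [Finset.smul_sum, smul_smul]

section Network

variable {n d m : ℕ} {x : Fin n → Vec d} {y : Fin n → ℝ} {a : Fin m → ℝ}

theorem jacobian_apply (θ : Fin m → Fin n → ℝ) (u : WeightSpace d m) (i : Fin n) :
    jacobian x a θ u i = ∑ r, inner ℝ (outputGrad x a (θ r i) r i) (u r) := rfl

theorem jacobianTranspose_apply (θ : Fin m → Fin n → ℝ) (z : EuclideanSpace ℝ (Fin n))
    (r : Fin m) : jacobianTranspose x a θ z r = ∑ i, z i • outputGrad x a (θ r i) r i := rfl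

theorem inner_jacobianTranspose (θ : Fin m → Fin n → ℝ) (z : EuclideanSpace ℝ (Fin n))
    (u : WeightSpace d m) :
    inner ℝ (jacobianTranspose x a θ z) u = inner ℝ z (jacobian x a θ u) := by
  rw [PiLp.inner_apply, PiLp.inner_apply]
  simp only [jacobian_apply, jacobianTranspose_apply, sum_inner, real_inner_smul_left]
  rw [Finset.sum_comm]
  refine Finset.sum_congr rfl fun i _ => ?_
  simp [← Finset.mul_sum, mul_comm]

theorem norm_jacobianTranspose_sq (w : Fin m → Vec d) (z : EuclideanSpace ℝ (Fin n)) :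
    ‖jacobianTranspose x a (fun r i => reluDeriv (inner ℝ (w r) (x i))) z‖ ^ 2 =
      z.ofLp ⬝ᵥ (gram x a w).mulVec z.ofLp := by
  rw [← real_inner_self_eq_norm_sq, PiLp.inner_apply]
  simp only [jacobianTranspose_apply, sum_inner, inner_sum, real_inner_smul_left,
    real_inner_smul_right, dotProduct, Matrix.mulVec, gram, Matrix.of_apply, Finset.mul_sum,
    Finset.sum_mul]
  rw [Finset.sum_comm]
  refine Finset.sum_congr rfl fun i _ => ?_
  rw [Finset.sum_comm]
  refine Finset.sum_congr rfl fun j _ => Finset.sum_congr rfl fun r _ => ?_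
  rw [real_inner_comm]
  ring

theorem norm_jacobian_sub_sq_le (θ θ' : Fin m → Fin n → ℝ) (u : WeightSpace d m) :
    ‖jacobian x a θ u - jacobian x a θ' u‖ ^ 2 ≤
      (∑ i, ∑ r, ‖outputGrad x a (θ r i - θ' r i) r i‖ ^ 2) * ‖u‖ ^ 2 := by
  rw [PiLp.norm_sq_eq_of_L2, PiLp.norm_sq_eq_of_L2, Finset.sum_mul]
  refine Finset.sum_le_sum fun i _ => ?_
  have h1 : (jacobian x a θ u - jacobian x a θ' u) i =
      ∑ r, inner ℝ (outputGrad x a (θ r i - θ' r i) r i) (u r) := by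
    rw [PiLp.sub_apply, jacobian_apply, jacobian_apply, ← Finset.sum_sub_distrib]
    refine Finset.sum_congr rfl fun r _ => ?_
    rw [← inner_sub_left, outputGrad, outputGrad, outputGrad, ← sub_smul, mul_sub]
  rw [h1]
  calc ‖∑ r, inner ℝ (outputGrad x a (θ r i - θ' r i) r i) (u r)‖ ^ 2
      ≤ (∑ r, ‖outputGrad x a (θ r i - θ' r i) r i‖ * ‖u r‖) ^ 2 := by
        gcongr
        exact (norm_sum_le _ _).trans (Finset.sum_le_sum fun r _ => norm_inner_le_norm _ _)
    _ ≤ _ := Finset.sum_mul_sq_le_sq_mul_sq _ _ _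

theorem norm_outputGrad_sq (ha : ∀ r, a r ^ 2 = 1) (τ : ℝ) (r : Fin m) (i : Fin n) :
    ‖outputGrad x a τ r i‖ ^ 2 = 1 / m * (τ ^ 2 * ‖x i‖ ^ 2) := by
  rw [outputGrad, norm_smul, mul_pow, Real.norm_eq_abs, sq_abs, mul_pow, mul_pow, ha, div_pow,
    Real.sq_sqrt (Nat.cast_nonneg m)]
  ring

/-- The share of neurons whose activation at `x_i` may change when the weights `w_r` move by at
most `R`, weighted by `‖x_i‖²` and summed over `i`. -/
noncomputable def kinkMass (x : Fin n → Vec d) (R : ℝ) (w : Fin m → Vec d) : ℝ :=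
  ∑ i, ∑ r, 1 / (m : ℝ) * (‖x i‖ ^ 2 *
    {z : Vec d | |inner ℝ z (x i)| ≤ R * ‖x i‖}.indicator (fun _ => (1 : ℝ)) (w r))

theorem sq_slope_sub_le_indicator {R : ℝ} {w₀ w ξ : Vec d} (hw : ‖w - w₀‖ ≤ R) {θ : ℝ}
    (hθ : θ ∈ reluSlopes (inner ℝ w ξ)) :
    (θ - reluDeriv (inner ℝ w₀ ξ)) ^ 2 ≤
      {z : Vec d | |inner ℝ z ξ| ≤ R * ‖ξ‖}.indicator (fun _ => (1 : ℝ)) w₀ := by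
  by_cases h : |inner ℝ w₀ ξ| ≤ R * ‖ξ‖
  · rw [indicator_of_mem (show w₀ ∈ {z : Vec d | |inner ℝ z ξ| ≤ R * ‖ξ‖} from h)]
    obtain ⟨h0, h1⟩ := reluSlopes_subset_Icc _ hθ
    unfold reluDeriv
    split_ifs <;> nlinarith
  · rw [indicator_of_notMem (show w₀ ∉ {z : Vec d | |inner ℝ z ξ| ≤ R * ‖ξ‖} from h)]
    have hd : |inner ℝ w ξ - inner ℝ w₀ ξ| ≤ R * ‖ξ‖ := by
      rw [← inner_sub_left]
      exact (abs_real_inner_le_norm _ _).trans (by gcongr)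
    obtain ⟨h1, h2⟩ := abs_le.mp hd
    rcases lt_abs.mp (not_le.mp h) with h3 | h3
    · have hp : 0 < (inner ℝ w ξ : ℝ) := by linarith
      have hp' : 0 ≤ (inner ℝ w₀ ξ : ℝ) := by
        linarith [(abs_nonneg _).trans hd]
      have : θ = 1 := by simpa [reluSlopes, hp] using hθ
      simp [this, reluDeriv, hp']
    · have hp : (inner ℝ w ξ : ℝ) < 0 := by linarith
      have hp' : (inner ℝ w₀ ξ : ℝ) < 0 := by
        linarith [(abs_nonneg _).trans hd]
      have : θ = 0 := by simpa [reluSlopes, hp, hp.le.not_gt] using hθ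
      simp [this, reluDeriv, hp'.not_ge]

theorem norm_jacobian_sub_sq_le_kinkMass (ha : ∀ r, a r ^ 2 = 1) {R : ℝ} {w₀ w : Fin m → Vec d}
    (hw : ∀ r, ‖w r - w₀ r‖ ≤ R) {θ : Fin m → Fin n → ℝ}
    (hθ : ∀ r i, θ r i ∈ reluSlopes (inner ℝ (w r) (x i))) (u : WeightSpace d m) :
    ‖jacobian x a θ u - jacobian x a (fun r i => reluDeriv (inner ℝ (w₀ r) (x i))) u‖ ^ 2 ≤
      kinkMass x R w₀ * ‖u‖ ^ 2 := by
  refine (norm_jacobian_sub_sq_le _ _ u).trans ?_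
  refine mul_le_mul_of_nonneg_right ?_ (sq_nonneg _)
  refine Finset.sum_le_sum fun i _ => Finset.sum_le_sum fun r _ => ?_
  rw [norm_outputGrad_sq ha, mul_comm (_ ^ 2) (‖x i‖ ^ 2)]
  gcongr
  exact sq_slope_sub_le_indicator (hw r) (hθ r i)

theorem norm_lossGrad_le {K : ℝ} (hx : ∀ i, ‖x i‖ ≤ K) (ha : ∀ r, a r ^ 2 = 1)
    (w : Fin m → Vec d) {θ : Fin m → Fin n → ℝ} (hθ : ∀ r i, θ r i ∈ Icc (0 : ℝ) 1) (r : Fin m) :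
    ‖lossGrad x y a w θ r‖ ≤
      K * Real.sqrt n / Real.sqrt m * ‖WithLp.toLp 2 (netResidual x y a w)‖ := by
  have hterm : ∀ i, ‖netResidual x y a w i • outputGrad x a (θ r i) r i‖ ≤
      |netResidual x y a w i| * (K / Real.sqrt m) := fun i => by
    have hK : 0 ≤ K := (norm_nonneg _).trans (hx i)
    rw [norm_smul, Real.norm_eq_abs]
    gcongr
    refine abs_le_of_sq_le_sq' ?_ (by positivity) |>.2
    rw [norm_outputGrad_sq ha, div_pow, Real.sq_sqrt (Nat.cast_nonneg m), div_eq_inv_mul (K ^ 2),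
      one_div]
    gcongr
    obtain ⟨h0, h1⟩ := hθ r i
    have h2 : θ r i ^ 2 ≤ 1 := by nlinarith
    have h3 : ‖x i‖ ^ 2 ≤ K ^ 2 := pow_le_pow_left₀ (norm_nonneg _) (hx i) 2
    calc θ r i ^ 2 * ‖x i‖ ^ 2 ≤ 1 * K ^ 2 := by gcongr
      _ = K ^ 2 := one_mul _
  have hsum : ∑ i, |netResidual x y a w i| ≤
      Real.sqrt n * ‖WithLp.toLp 2 (netResidual x y a w)‖ := by
    refine abs_le_of_sq_le_sq' ?_ (by positivity) |>.2
    rw [mul_pow, Real.sq_sqrt (Nat.cast_nonneg n), PiLp.norm_sq_eq_of_L2]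
    have := sq_sum_le_card_mul_sum_sq (s := Finset.univ) (f := fun i => |netResidual x y a w i|)
    simpa using this
  rcases n.eq_zero_or_pos with rfl | hn
  · simp [lossGrad]
  have hK : 0 ≤ K := (norm_nonneg _).trans (hx ⟨0, hn⟩)
  calc ‖lossGrad x y a w θ r‖ ≤ ∑ i, |netResidual x y a w i| * (K / Real.sqrt m) :=
        (norm_sum_le _ _).trans (Finset.sum_le_sum fun i _ => hterm i)
    _ = (∑ i, |netResidual x y a w i|) * (K / Real.sqrt m) := by rw [Finset.sum_mul]
    _ ≤ (Real.sqrt n * ‖WithLp.toLp 2 (netResidual x y a w)‖) * (K / Real.sqrt m) := by gcongr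
    _ = _ := by ring

end Network

/-! ### Regularity of solutions -/

namespace IsHeavyBallSolution

variable {n d m : ℕ} {x : Fin n → Vec d} {y : Fin n → ℝ} {a : Fin m → ℝ} {α s : ℝ}
  {w₀ : Fin m → Vec d} {w v : ℝ → Fin m → Vec d} {θ : ℝ → Fin m → Fin n → ℝ}

theorem continuousOn_weight (h : IsHeavyBallSolution x y a α s w₀ w v θ) (r : Fin m) :
    ContinuousOn (fun t => w t r) (Ici 0) :=
  fun t ht => (h.velocity t ht r).continuousWithinAt

theorem continuousOn_residual (h : IsHeavyBallSolution x y a α s w₀ w v θ) (i : Fin n) :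
    ContinuousOn (fun t => netResidual x y a (w t) i) (Ici 0) := by
  unfold netResidual network
  refine ContinuousOn.sub (continuousOn_const.mul ?_) continuousOn_const
  refine continuousOn_finsetSum _ fun r _ => continuousOn_const.mul ?_
  exact lipschitzWith_relu.continuous.comp_continuousOn
    ((h.continuousOn_weight r).inner continuousOn_const)

theorem exists_lipschitzOnWith_weight (h : IsHeavyBallSolution x y a α s w₀ w v θ) (T : ℝ)
    (r : Fin m) : ∃ C : NNReal, LipschitzOnWith C (fun t => w t r) (Icc 0 T) := by
  obtain ⟨B, hB⟩ := isCompact_Icc.exists_bound_of_continuousOn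
    ((h.velocity_continuous r).mono (Icc_subset_Ici_self : Icc 0 T ⊆ Ici 0))
  refine ⟨B.toNNReal, (convex_Icc 0 T).lipschitzOnWith_of_nnnorm_hasDerivWithin_le
    (fun t ht => (h.velocity t ht.1 r).mono Icc_subset_Ici_self) fun t ht => ?_⟩
  rw [← NNReal.coe_le_coe, coe_nnnorm]
  exact (hB t ht).trans (Real.le_coe_toNNReal B)

theorem exists_lipschitzOnWith_residual (h : IsHeavyBallSolution x y a α s w₀ w v θ) (T : ℝ) :
    ∃ C : NNReal, LipschitzOnWith C (fun t => WithLp.toLp 2 (netResidual x y a (w t)))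
      (Icc 0 T) := by
  choose C hC using h.exists_lipschitzOnWith_weight T
  have key : ∀ i, ∃ D : ℝ, 0 ≤ D ∧ ∀ t ∈ Icc 0 T, ∀ u ∈ Icc 0 T,
      |netResidual x y a (w t) i - netResidual x y a (w u) i| ≤ D * |t - u| := by
    intro i
    refine ⟨1 / Real.sqrt m * ∑ r, |a r| * (C r * ‖x i‖), by positivity, fun t ht u hu => ?_⟩
    have e : netResidual x y a (w t) i - netResidual x y a (w u) i = 1 / Real.sqrt m *
        ∑ r, a r * (relu (inner ℝ (w t r) (x i)) - relu (inner ℝ (w u r) (x i))) := by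
      simp only [netResidual, network, mul_sub, Finset.sum_sub_distrib]
      ring
    rw [e, abs_mul, abs_of_nonneg (by positivity : (0 : ℝ) ≤ 1 / Real.sqrt m), mul_assoc,
      Finset.sum_mul]
    refine mul_le_mul_of_nonneg_left ?_ (by positivity)
    refine (Finset.abs_sum_le_sum_abs _ _).trans (Finset.sum_le_sum fun r _ => ?_)
    rw [abs_mul, mul_assoc]
    refine mul_le_mul_of_nonneg_left ?_ (abs_nonneg _)
    have h1 := lipschitzWith_relu.dist_le_mul (inner ℝ (w t r) (x i)) (inner ℝ (w u r) (x i))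
    rw [NNReal.coe_one, one_mul, Real.dist_eq, Real.dist_eq, ← inner_sub_left] at h1
    have h2 := (hC r).dist_le_mul t ht u hu
    rw [dist_eq_norm, Real.dist_eq] at h2
    calc _ ≤ |inner ℝ (w t r - w u r) (x i)| := h1
      _ ≤ ‖w t r - w u r‖ * ‖x i‖ := abs_real_inner_le_norm _ _
      _ ≤ (C r * |t - u|) * ‖x i‖ := by gcongr
      _ = _ := by ring
  choose D hD0 hD using key
  refine ⟨(∑ i, D i).toNNReal, LipschitzOnWith.of_dist_le_mul fun t ht u hu => ?_⟩
  rw [Real.coe_toNNReal _ (Finset.sum_nonneg fun i _ => hD0 i), dist_eq_norm, ← WithLp.toLp_sub,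
    Real.dist_eq]
  refine le_of_sq_le_sq ?_ (mul_nonneg (Finset.sum_nonneg fun i _ => hD0 i) (abs_nonneg _))
  rw [PiLp.norm_sq_eq_of_L2, Finset.sum_mul]
  have hnn : ∀ i ∈ Finset.univ, 0 ≤ D i * |t - u| := fun i _ => mul_nonneg (hD0 i) (abs_nonneg _)
  refine le_trans (Finset.sum_le_sum fun i _ => ?_) (Finset.sum_sq_le_sq_sum_of_nonneg hnn)
  rw [Real.norm_eq_abs]
  exact pow_le_pow_left₀ (abs_nonneg _) (hD i t ht u hu) 2

theorem aestronglyMeasurable_lossGrad (h : IsHeavyBallSolution x y a α s w₀ w v θ) (T : ℝ)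
    (r : Fin m) :
    AEStronglyMeasurable (fun u => lossGrad x y a (w u) (θ u) r) (volume.restrict (Ioc 0 T)) := by
  unfold lossGrad outputGrad
  refine Finset.aestronglyMeasurable_fun_sum _ fun i _ => ?_
  have h1 : AEStronglyMeasurable (fun u => netResidual x y a (w u) i)
      (volume.restrict (Ioc 0 T)) :=
    ((h.continuousOn_residual i).mono (fun u hu => hu.1.le)).aestronglyMeasurable
      measurableSet_Ioc
  have h2 : Measurable fun u => (1 / Real.sqrt m * a r * θ u r i) • x i :=
    ((h.slope_measurable r i).const_mul _).smul_const _
  exact h1.smul h2.aestronglyMeasurable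

theorem exists_bound_lossGrad (h : IsHeavyBallSolution x y a α s w₀ w v θ) (T : ℝ) (r : Fin m) :
    ∃ B : ℝ, ∀ u ∈ Icc 0 T, ‖lossGrad x y a (w u) (θ u) r‖ ≤ B := by
  have key : ∀ i, ∃ B : ℝ, ∀ u ∈ Icc 0 T, ‖netResidual x y a (w u) i‖ ≤ B := fun i =>
    isCompact_Icc.exists_bound_of_continuousOn
      ((h.continuousOn_residual i).mono Icc_subset_Ici_self)
  choose B hB using key
  refine ⟨∑ i, B i * (|1 / Real.sqrt m * a r| * ‖x i‖), fun u hu => ?_⟩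
  refine (norm_sum_le _ _).trans (Finset.sum_le_sum fun i _ => ?_)
  rw [norm_smul]
  have hB0 : 0 ≤ B i := (norm_nonneg _).trans (hB i u hu)
  gcongr
  · exact hB i u hu
  · obtain ⟨h0, h1⟩ := reluSlopes_subset_Icc _ (h.slope_mem u hu.1 r i)
    rw [outputGrad, norm_smul, Real.norm_eq_abs, abs_mul (_ * _)]
    gcongr
    rw [abs_of_nonneg h0]
    exact mul_le_of_le_one_right (abs_nonneg _) h1

theorem intervalIntegrable_lossGrad (h : IsHeavyBallSolution x y a α s w₀ w v θ) {T : ℝ}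
    (hT : 0 ≤ T) (r : Fin m) :
    IntervalIntegrable (fun u => lossGrad x y a (w u) (θ u) r) volume 0 T := by
  obtain ⟨B, hB⟩ := h.exists_bound_lossGrad T r
  rw [intervalIntegrable_iff_integrableOn_Ioc_of_le hT]
  refine IntegrableOn.of_bound (by simp) (h.aestronglyMeasurable_lossGrad T r) B ?_
  filter_upwards [ae_restrict_mem measurableSet_Ioc] with u hu using hB u ⟨hu.1.le, hu.2⟩

theorem intervalIntegrable_velocity (h : IsHeavyBallSolution x y a α s w₀ w v θ) {T : ℝ}
    (hT : 0 ≤ T) (r : Fin m) : IntervalIntegrable (fun u => v u r) volume 0 T := by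
  refine ContinuousOn.intervalIntegrable ((h.velocity_continuous r).mono ?_)
  rw [uIcc_of_le hT]
  exact Icc_subset_Ici_self

theorem intervalIntegrable_force (h : IsHeavyBallSolution x y a α s w₀ w v θ) {T : ℝ}
    (hT : 0 ≤ T) (r : Fin m) :
    IntervalIntegrable (fun u => -(2 * Real.sqrt α) • v u r -
      (1 + Real.sqrt (α * s)) • lossGrad x y a (w u) (θ u) r) volume 0 T := by
  have h1 := (h.intervalIntegrable_velocity hT r).smul (-(2 * Real.sqrt α))
  have h2 := (h.intervalIntegrable_lossGrad hT r).smul (1 + Real.sqrt (α * s))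
  exact h1.sub h2

theorem exists_lipschitzOnWith_velocity (h : IsHeavyBallSolution x y a α s w₀ w v θ) {T : ℝ}
    (r : Fin m) : ∃ C : NNReal, LipschitzOnWith C (fun t => v t r) (Icc 0 T) := by
  obtain ⟨B, hB⟩ := h.exists_bound_lossGrad T r
  obtain ⟨D, hD⟩ := isCompact_Icc.exists_bound_of_continuousOn
    ((h.velocity_continuous r).mono (Icc_subset_Ici_self : Icc 0 T ⊆ Ici 0))
  set L := |-(2 * Real.sqrt α)| * D + |1 + Real.sqrt (α * s)| * B with hL
  refine ⟨L.toNNReal, LipschitzOnWith.of_dist_le_mul fun t ht u hu => ?_⟩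
  rw [dist_eq_norm, h.ode t ht.1 r, h.ode u hu.1 r, intervalIntegral.integral_interval_sub_left
    (h.intervalIntegrable_force ht.1 r) (h.intervalIntegrable_force hu.1 r), Real.dist_eq]
  refine (intervalIntegral.norm_integral_le_of_norm_le_const fun p hp => ?_).trans
    (mul_le_mul_of_nonneg_right (Real.le_coe_toNNReal L) (abs_nonneg _))
  have hpT : p ∈ Icc 0 T := uIcc_subset_Icc hu ht (uIoc_subset_uIcc hp)
  refine (norm_sub_le _ _).trans ?_
  rw [norm_smul, norm_smul, hL]
  exact add_le_add (mul_le_mul_of_nonneg_left (hD p hpT) (norm_nonneg _))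
    (mul_le_mul_of_nonneg_left (hB p hpT) (norm_nonneg _))

theorem hasDerivAt_weight (h : IsHeavyBallSolution x y a α s w₀ w v θ) {t : ℝ} (ht : 0 < t)
    (r : Fin m) : HasDerivAt (fun u => w u r) (v t r) t :=
  (h.velocity t ht.le r).hasDerivAt (Ici_mem_nhds ht)

theorem ae_hasDerivAt_velocity (h : IsHeavyBallSolution x y a α s w₀ w v θ) {T : ℝ}
    (hT : 0 ≤ T) (r : Fin m) :
    ∀ᵐ t, t ∈ Ioo 0 T → HasDerivAt (fun u => v u r) (-(2 * Real.sqrt α) • v t r -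
      (1 + Real.sqrt (α * s)) • lossGrad x y a (w t) (θ t) r) t := by
  filter_upwards [(h.intervalIntegrable_force hT r).ae_hasDerivAt_integral] with t ht hmem
  have h1 := ht (by rw [uIcc_of_le hT]; exact Ioo_subset_Icc_self hmem) 0 left_mem_uIcc
  refine h1.congr_of_eventuallyEq ?_
  filter_upwards [lt_mem_nhds hmem.1] with u hu using h.ode u hu.le r

theorem ae_hasDerivAt_residual (h : IsHeavyBallSolution x y a α s w₀ w v θ) {T : ℝ}
    (hT : 0 ≤ T) (i : Fin n) :
    ∀ᵐ t, t ∈ Ioo 0 T → HasDerivAt (fun u => netResidual x y a (w u) i)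
      (∑ r, inner ℝ (outputGrad x a (θ t r i) r i) (v t r)) t := by
  have hrelu : ∀ r, ∀ᵐ t, t ∈ Ioo 0 T →
      DifferentiableAt ℝ (fun u => relu (inner ℝ (w u r) (x i))) t := by
    intro r
    obtain ⟨C, hC⟩ := h.exists_lipschitzOnWith_weight T r
    have hL := lipschitzWith_relu.comp_lipschitzOnWith
      ((innerSL ℝ (x i)).lipschitz.comp_lipschitzOnWith hC)
    rw [← uIcc_of_le hT] at hL
    filter_upwards [hL.absolutelyContinuousOnInterval.ae_differentiableAt] with t ht hmem
    have := ht (by rw [uIcc_of_le hT]; exact Ioo_subset_Icc_self hmem)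
    simpa only [Function.comp_def, innerSL_apply_apply, real_inner_comm (x i)] using this
  filter_upwards [ae_all_iff.mpr hrelu] with t ht hmem
  have hr : ∀ r, HasDerivAt (fun u => relu (inner ℝ (w u r) (x i)))
      (θ t r i * inner ℝ (v t r) (x i)) t := by
    intro r
    have h1 : HasDerivAt (fun u => (inner ℝ (w u r) (x i) : ℝ)) (inner ℝ (v t r) (x i)) t := by
      simpa using (h.hasDerivAt_weight hmem.1 r).inner ℝ (hasDerivAt_const t (x i))
    have h2 := (ht r hmem).hasDerivAt
    rwa [deriv_relu_comp_eq_slope_mul h1 h2 (h.slope_mem t hmem.1.le r i)] at h2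
  have h3 := ((HasDerivAt.fun_sum (u := Finset.univ) fun r _ =>
    (hr r).const_mul (a r)).const_mul (1 / Real.sqrt m)).sub_const (y i)
  refine h3.congr_deriv ?_
  rw [Finset.mul_sum]
  refine Finset.sum_congr rfl fun r _ => ?_
  rw [outputGrad, real_inner_smul_left, real_inner_comm]
  ring

end IsHeavyBallSolution

/-! ### Convergence from a well-conditioned initialization -/

namespace IsHeavyBallSolution

variable {n d m : ℕ} {x : Fin n → Vec d} {y : Fin n → ℝ} {a : Fin m → ℝ} {α s : ℝ}
  {w₀ : Fin m → Vec d} {w v : ℝ → Fin m → Vec d} {θ : ℝ → Fin m → Fin n → ℝ}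

/-- The residual decays exponentially for as long as every weight stays within `R` of its initial
value. The constant `3 / 400` makes the Jacobian stay within a tenth of its smallest singular
value, relatively, of its initial value. -/
theorem residual_decay {lam R T : ℝ} (h : IsHeavyBallSolution x y a (lam / 2) s w₀ w v θ)
    (hlam : 0 < lam) (ha : ∀ r, a r ^ 2 = 1)
    (hgram : ∀ z : EuclideanSpace ℝ (Fin n),
      3 / 4 * lam * ‖z‖ ^ 2 ≤ z.ofLp ⬝ᵥ (gram x a w₀).mulVec z.ofLp)
    (hkink : kinkMass x R w₀ ≤ 3 / 400 * lam) (hT : 0 ≤ T)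
    (hR : ∀ u ∈ Icc 0 T, ∀ r, ‖w u r - w₀ r‖ ≤ R) :
    ‖WithLp.toLp 2 (netResidual x y a (w T))‖ ^ 2 ≤
      5 / 4 * ‖WithLp.toLp 2 (netResidual x y a w₀)‖ ^ 2 *
        Real.exp (-((2 - √2) * √(lam / 2)) * T) := by
  obtain ⟨M, hinv, hM, hproj⟩ := exists_rightInverse_of_transpose_bounded_below
    (jacobian x a fun r i => reluDeriv (inner ℝ (w₀ r) (x i))) (jacobianTranspose x a _)
    (inner_jacobianTranspose _) (μ := 3 / 4 * lam) (by positivity)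
    (fun z => (hgram z).trans_eq (norm_jacobianTranspose_sq w₀ z).symm)
  have hε : 0 < √(3 / 400 * lam) := Real.sqrt_pos.mpr (by positivity)
  have hMε : ∀ z, √(3 / 400 * lam) * ‖M z‖ ≤ ‖z‖ / 10 := fun z => by
    refine le_of_sq_le_sq ?_ (by positivity)
    rw [mul_pow, Real.sq_sqrt (by positivity)]
    linarith [hM z]
  have hMσ : ∀ z, √(lam / 2) * ‖M z‖ ≤ 5 / 6 * ‖z‖ := fun z => by
    refine le_of_sq_le_sq ?_ (by positivity)
    rw [mul_pow, Real.sq_sqrt (by positivity)]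
    nlinarith [hM z, sq_nonneg ‖z‖]
  obtain ⟨C₁, hC₁⟩ := h.exists_lipschitzOnWith_residual T
  have hv : ∃ C : NNReal, LipschitzOnWith C (fun t => (WithLp.toLp 2 (v t) : WeightSpace d m))
      (Icc 0 T) := by
    choose C hC using fun r => h.exists_lipschitzOnWith_velocity (T := T) r
    have h1 : LipschitzOnWith (Finset.univ.sup C) v (Icc 0 T) := by
      refine LipschitzOnWith.of_dist_le_mul fun t ht u hu => ?_
      refine (dist_pi_le_iff (by positivity)).mpr fun r => ?_
      refine ((hC r).dist_le_mul t ht u hu).trans ?_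
      gcongr
      exact_mod_cast Finset.le_sup (f := C) (Finset.mem_univ r)
    exact ⟨_, (PiLp.lipschitzWith_toLp 2 _).comp_lipschitzOnWith h1⟩
  obtain ⟨C₂, hC₂⟩ := hv
  have key := oscillator_decay (Real.sqrt_pos.mpr (by positivity : 0 < lam / 2))
    (c := 1 + √(lam / 2 * s)) (by linarith [Real.sqrt_nonneg (lam / 2 * s)]) hε hinv hproj hMε hMσ
    hT hC₁ hC₂ (by simp [h.init_velocity]) ?_
  · simpa only [h.init] using key
  · filter_upwards [ae_all_iff.mpr fun r => h.ae_hasDerivAt_velocity hT r,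
      ae_all_iff.mpr fun i => h.ae_hasDerivAt_residual hT i] with t hv hΔ hmem
    have ht := Ioo_subset_Icc_self hmem
    refine ⟨jacobian x a (θ t), jacobianTranspose x a (θ t)
      (WithLp.toLp 2 (netResidual x y a (w t))), fun u => ?_, inner_jacobianTranspose _ _, ?_, ?_⟩
    · refine le_of_sq_le_sq ?_ (by positivity)
      rw [mul_pow, Real.sq_sqrt (by positivity)]
      refine (norm_jacobian_sub_sq_le_kinkMass ha (hR t ht) (h.slope_mem t ht.1) u).trans ?_
      gcongr
    · have h1 : HasDerivAt (fun u => netResidual x y a (w u))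
          (fun i => ∑ r, inner ℝ (outputGrad x a (θ t r i) r i) (v t r)) t :=
        hasDerivAt_pi.mpr fun i => hΔ i hmem
      exact (PiLp.continuousLinearEquiv 2 ℝ fun _ : Fin n => ℝ).symm.hasFDerivAt.comp_hasDerivAt t h1
    · have h1 : HasDerivAt v (fun r => -(2 * Real.sqrt (lam / 2)) • v t r -
          (1 + Real.sqrt (lam / 2 * s)) • lossGrad x y a (w t) (θ t) r) t :=
        hasDerivAt_pi.mpr fun r => hv r hmem
      exact (PiLp.continuousLinearEquiv 2 ℝ fun _ : Fin m => Vec d).symm.hasFDerivAt.comp_hasDerivAt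
        t h1

theorem velocity_eq (h : IsHeavyBallSolution x y a α s w₀ w v θ) {t : ℝ} (ht : 0 ≤ t)
    (r : Fin m) : v t r = -(2 * Real.sqrt α) • (w t r - w₀ r) -
      (1 + Real.sqrt (α * s)) • ∫ u in (0 : ℝ)..t, lossGrad x y a (w u) (θ u) r := by
  have h1 : ∫ u in (0 : ℝ)..t, v u r = w t r - w₀ r := by
    rw [← h.init]
    refine intervalIntegral.integral_eq_sub_of_hasDeriv_right_of_le ht
      ((h.continuousOn_weight r).mono Icc_subset_Ici_self)
      (fun u hu => (h.hasDerivAt_weight hu.1 r).hasDerivWithinAt)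
      (h.intervalIntegrable_velocity ht r)
  rw [h.ode t ht r, ← h1, ← intervalIntegral.integral_smul, ← intervalIntegral.integral_smul]
  have h2 := (h.intervalIntegrable_velocity ht r).smul (-(2 * Real.sqrt α))
  have h3 := (h.intervalIntegrable_lossGrad ht r).smul (1 + Real.sqrt (α * s))
  exact intervalIntegral.integral_sub h2 h3

/-- The friction turns an exponentially decaying gradient into a bounded displacement: `w - w₀` solves
`z' = -2 √α z - (1 + √(α s)) ∫ ∂L/∂w_r` with `z(0) = 0`. -/
theorem norm_displacement_le (h : IsHeavyBallSolution x y a α s w₀ w v θ) (hα : 0 < α)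
    {T b η : ℝ} (hT : 0 ≤ T) (hη : 0 < η) (hb : 0 ≤ b) {r : Fin m}
    (hgrad : ∀ u ∈ Icc 0 T, ‖lossGrad x y a (w u) (θ u) r‖ ≤ b * Real.exp (-η * u)) :
    ‖w T r - w₀ r‖ ≤ (1 + Real.sqrt (α * s)) * (b / η) / (2 * Real.sqrt α) := by
  set σ := Real.sqrt α with hσ
  set c := 1 + Real.sqrt (α * s) with hc
  have hσ0 : 0 < σ := Real.sqrt_pos.mpr hα
  have hc0 : 0 ≤ c := by positivity
  set I : ℝ → Vec d := fun t => ∫ u in (0 : ℝ)..t, lossGrad x y a (w u) (θ u) r with hI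
  have hIb : ∀ t ∈ Icc 0 T, ‖I t‖ ≤ b / η := by
    intro t ht
    have hd : ∀ u ∈ uIcc 0 t, HasDerivAt (fun u => -(b / η) * Real.exp (-η * u))
        (b * Real.exp (-η * u)) u := by
      intro u _
      have h1 : HasDerivAt (fun u => Real.exp (-η * u)) (Real.exp (-η * u) * -η) u := by
        simpa using ((hasDerivAt_id u).const_mul (-η)).exp
      refine (h1.const_mul _).congr_deriv ?_
      field_simp
    have hint : IntervalIntegrable (fun u => b * Real.exp (-η * u)) volume 0 t :=
      Continuous.intervalIntegrable (by fun_prop) _ _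
    have h1 : ‖I t‖ ≤ ∫ u in (0 : ℝ)..t, b * Real.exp (-η * u) := by
      refine intervalIntegral.norm_integral_le_of_norm_le ht.1 ?_ hint
      exact Filter.Eventually.of_forall fun u hu => hgrad u ⟨hu.1.le, hu.2.trans ht.2⟩
    rw [intervalIntegral.integral_eq_sub_of_hasDerivAt hd hint] at h1
    have h2 : 0 ≤ b / η * Real.exp (-η * t) := by positivity
    rw [mul_zero, Real.exp_zero] at h1
    linarith
  have hv : ∀ t ∈ Icc 0 T, v t r = -(2 * σ) • (w t r - w₀ r) - c • I t :=
    fun t ht => h.velocity_eq ht.1 r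
  have hexp : ∀ t : ℝ, HasDerivAt (fun t => Real.exp (2 * σ * t))
      (Real.exp (2 * σ * t) * (2 * σ)) t := fun t => by
    simpa using ((hasDerivAt_id t).const_mul (2 * σ)).exp
  have main : ‖Real.exp (2 * σ * T) • (w T r - w₀ r)‖ ≤
      c * (b / η) / (2 * σ) * (Real.exp (2 * σ * T) - 1) := by
    refine image_norm_le_of_norm_deriv_right_le_deriv_boundary (a := 0) (b := T)
      (f := fun t => Real.exp (2 * σ * t) • (w t r - w₀ r))
      (f' := fun t => Real.exp (2 * σ * t) • v t r +
        (Real.exp (2 * σ * t) * (2 * σ)) • (w t r - w₀ r))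
      (B := fun t => c * (b / η) / (2 * σ) * (Real.exp (2 * σ * t) - 1))
      (B' := fun t => c * (b / η) / (2 * σ) * (Real.exp (2 * σ * t) * (2 * σ)))
      ?_ ?_ ?_ ?_ ?_ (right_mem_Icc.mpr hT)
    · have hc : Continuous fun t => Real.exp (2 * σ * t) := by fun_prop
      refine hc.continuousOn.smul ?_
      exact ((h.continuousOn_weight r).mono Icc_subset_Ici_self).sub continuousOn_const
    · intro t ht
      exact (hexp t).hasDerivWithinAt.smul
        (((h.velocity t ht.1 r).mono (Ici_subset_Ici.mpr ht.1)).sub_const _)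
    · simp [h.init]
    · intro t
      exact ((hexp t).sub_const 1).const_mul _
    · intro t ht
      have e : Real.exp (2 * σ * t) • v t r +
          (Real.exp (2 * σ * t) * (2 * σ)) • (w t r - w₀ r) =
          -(Real.exp (2 * σ * t) * c) • I t := by
        rw [hv t (Ico_subset_Icc_self ht)]
        module
      rw [e, norm_smul, norm_neg, Real.norm_eq_abs, abs_of_nonneg (by positivity)]
      calc Real.exp (2 * σ * t) * c * ‖I t‖ ≤ Real.exp (2 * σ * t) * c * (b / η) := by
            gcongr
            exact hIb t (Ico_subset_Icc_self ht)
        _ = _ := by field_simp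
  rw [norm_smul, Real.norm_eq_abs, abs_of_pos (Real.exp_pos _)] at main
  have hB : 0 ≤ c * (b / η) / (2 * σ) := by positivity
  have hE := Real.exp_pos (2 * σ * T)
  refine le_of_mul_le_mul_left ?_ hE
  linarith

/-- If the region in which `residual_decay` applies is wide enough for the resulting displacement,
then no weight ever leaves it. -/
theorem residual_decay_of_radius {lam R K : ℝ}
    (h : IsHeavyBallSolution x y a (lam / 2) s w₀ w v θ)
    (hlam : 0 < lam) (hs : √(lam / 2 * s) ≤ 1) (hx : ∀ i, ‖x i‖ ≤ K) (hK : 0 ≤ K)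
    (ha : ∀ r, a r ^ 2 = 1)
    (hgram : ∀ z : EuclideanSpace ℝ (Fin n),
      3 / 4 * lam * ‖z‖ ^ 2 ≤ z.ofLp ⬝ᵥ (gram x a w₀).mulVec z.ofLp)
    (hkink : kinkMass x R w₀ ≤ 3 / 400 * lam)
    (hR : 8 * (K * Real.sqrt n / Real.sqrt m) * ‖WithLp.toLp 2 (netResidual x y a w₀)‖ / lam < R)
    {t : ℝ} (ht : 0 ≤ t) :
    ‖WithLp.toLp 2 (netResidual x y a (w t))‖ ^ 2 ≤
      5 / 4 * ‖WithLp.toLp 2 (netResidual x y a w₀)‖ ^ 2 *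
        Real.exp (-((2 - √2) * √(lam / 2)) * t) := by
  set N := ‖WithLp.toLp 2 (netResidual x y a w₀)‖ with hN
  have hN0 : 0 ≤ N := norm_nonneg _
  set q := K * Real.sqrt n / Real.sqrt m with hq
  have hq0 : 0 ≤ q := by positivity
  set σ := √(lam / 2) with hσ
  have hσ0 : 0 < σ := Real.sqrt_pos.mpr (by positivity)
  have hσ2 : σ ^ 2 = lam / 2 := Real.sq_sqrt (by positivity)
  obtain ⟨hρ1, hρ2⟩ := two_sub_sqrt_two_bounds
  have hconf : ∀ T, 0 ≤ T → (∀ u ∈ Icc 0 T, ∀ r, ‖w u r - w₀ r‖ ≤ R) →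
      ∀ r, ‖w T r - w₀ r‖ < R := by
    intro T hT hRT r
    set η := (2 - √2) * σ / 2 with hη
    have hη0 : 0 < η := by
      have : 0 < 2 - √2 := by linarith
      positivity
    have hgrad : ∀ u ∈ Icc 0 T, ‖lossGrad x y a (w u) (θ u) r‖ ≤
        q * (9 / 8 * N) * Real.exp (-η * u) := by
      intro u hu
      have h1 := h.residual_decay hlam ha hgram hkink hu.1
        fun p hp => hRT p ⟨hp.1, hp.2.trans hu.2⟩
      have h2 : ‖WithLp.toLp 2 (netResidual x y a (w u))‖ ≤ 9 / 8 * N * Real.exp (-η * u) := by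
        refine le_of_sq_le_sq (h1.trans ?_) (by positivity)
        have e : Real.exp (-η * u) ^ 2 = Real.exp (-((2 - √2) * √(lam / 2)) * u) := by
          rw [← Real.exp_nat_mul]
          congr 1
          push_cast
          rw [hη]
          ring
        rw [mul_pow, e, mul_pow]
        gcongr
        norm_num
      refine (norm_lossGrad_le hx ha _
        (fun r i => reluSlopes_subset_Icc _ (h.slope_mem u hu.1 r i)) r).trans ?_
      rw [mul_assoc]
      gcongr
    have h3 := h.norm_displacement_le (by positivity) hT hη0 (by positivity) hgrad
    refine lt_of_le_of_lt (h3.trans ?_) hR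
    rw [hη]
    have e1 : (1 + √(lam / 2 * s)) * (q * (9 / 8 * N) / ((2 - √2) * σ / 2)) / (2 * σ) =
        (1 + √(lam / 2 * s)) * (9 / 8) / (2 - √2) * (q * N) / σ ^ 2 := by
      have : 2 - √2 ≠ 0 := by linarith
      field_simp
    have e2 : 8 * q * N / lam = 4 * (q * N) / σ ^ 2 := by
      rw [hσ2]
      field_simp
      ring
    rw [e1, e2]
    gcongr
    rw [div_le_iff₀ (by linarith)]
    linarith
  have hall : ∀ T, 0 ≤ T → ∀ r, ‖w T r - w₀ r‖ ≤ R := by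
    by_contra! hcon
    obtain ⟨T, hT, r, hr⟩ := hcon
    -- The first time at which some weight is at distance at least `R` from its initial value.
    set S : Set ℝ := ⋃ r : Fin m, Icc 0 T ∩ (fun t => ‖w t r - w₀ r‖) ⁻¹' Ici R with hS
    have hScomp : IsCompact S := by
      refine isCompact_iUnion fun r => isCompact_Icc.of_isClosed_subset ?_ inter_subset_left
      refine ContinuousOn.preimage_isClosed_of_isClosed ?_ isClosed_Icc isClosed_Ici
      exact (((h.continuousOn_weight r).mono Icc_subset_Ici_self).sub continuousOn_const).norm
    obtain ⟨τ, hτS, hτ⟩ := hScomp.exists_isLeast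
      ⟨T, mem_iUnion.mpr ⟨r, right_mem_Icc.mpr hT, hr.le⟩⟩
    obtain ⟨r', ⟨hτT, hτR⟩⟩ := mem_iUnion.mp hτS
    have hlt : ∀ u ∈ Ico 0 τ, ∀ r, ‖w u r - w₀ r‖ < R := by
      intro u hu r
      by_contra! hge
      exact hu.2.not_ge (hτ (mem_iUnion.mpr ⟨r, ⟨hu.1, hu.2.le.trans hτT.2⟩, hge⟩))
    have hle : ∀ u ∈ Icc 0 τ, ∀ r, ‖w u r - w₀ r‖ ≤ R := by
      have hτ0 : 0 < τ := by
        rcases hτT.1.eq_or_lt with h0 | h0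
        · have hR0 : R ≤ 0 := by
            have : R ≤ ‖w τ r' - w₀ r'‖ := hτR
            simpa [← h0, h.init] using this
          have : 0 ≤ 8 * q * N / lam := by positivity
          linarith
        · exact h0
      intro u hu r
      have hcont : ContinuousOn (fun t => ‖w t r - w₀ r‖) (Icc 0 τ) :=
        (((h.continuousOn_weight r).mono Icc_subset_Ici_self).sub continuousOn_const).norm
      have hu' := hu
      rw [← closure_Ico hτ0.ne] at hu'
      exact ((hcont u hu).mono Ico_subset_Icc_self).closure_le hu' continuousWithinAt_const
        fun p hp => (hlt p hp r).le
    have : R ≤ ‖w τ r' - w₀ r'‖ := hτR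
    exact (hconf τ hτT.1 hle r').not_ge this
  exact h.residual_decay hlam ha hgram hkink ht fun u hu r => hall u hu.1 r

end IsHeavyBallSolution

/-! ### The limiting kernel matrix -/

theorem Matrix.IsHermitian.sInf_spectrum_mul_norm_sq_le {n : ℕ} {A : Matrix (Fin n) (Fin n) ℝ}
    (hA : A.IsHermitian) (z : EuclideanSpace ℝ (Fin n)) :
    sInf (spectrum ℝ A) * ‖z‖ ^ 2 ≤ z.ofLp ⬝ᵥ A.mulVec z.ofLp := by
  set l := sInf (spectrum ℝ A) with hl
  have hsub : (A - algebraMap ℝ _ l).PosSemidef := by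
    refine Matrix.posSemidef_iff_isHermitian_and_spectrum_nonneg.mpr ⟨?_, ?_⟩
    · refine hA.sub ?_
      rw [Matrix.algebraMap_eq_diagonal]
      exact Matrix.isHermitian_diagonal _
    · rw [← spectrum.sub_singleton_eq]
      rintro _ ⟨μ, hμ, _, rfl, rfl⟩
      exact sub_nonneg.mpr (csInf_le A.finite_real_spectrum.bddBelow hμ)
  have h1 := hsub.dotProduct_mulVec_nonneg z.ofLp
  rw [star_trivial, Matrix.sub_mulVec, dotProduct_sub, Algebra.algebraMap_eq_smul_one,
    Matrix.smul_mulVec, Matrix.one_mulVec, dotProduct_smul, smul_eq_mul] at h1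
  have h2 : z.ofLp ⬝ᵥ z.ofLp = ‖z‖ ^ 2 := by
    rw [PiLp.norm_sq_eq_of_L2]
    simp [dotProduct, pow_two]
  rw [h2] at h1
  linarith

section Kernel

variable {n d : ℕ} (x : Fin n → Vec d)

/-- The integrand of the entry `(i, j)` of `ntk x`. -/
noncomputable def ntkIntegrand (i j : Fin n) (w : Vec d) : ℝ :=
  inner ℝ (x i) (x j) * (reluDeriv (inner ℝ w (x i)) * reluDeriv (inner ℝ w (x j)))

theorem ntk_apply (i j : Fin n) :
    ntk x i j = ∫ w, ntkIntegrand x i j w ∂(stdGaussian (Vec d)) := rfl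

theorem measurable_reluDeriv : Measurable reluDeriv :=
  Measurable.ite measurableSet_Ici measurable_const measurable_const

theorem reluDeriv_mem_Icc (z : ℝ) : reluDeriv z ∈ Icc (0 : ℝ) 1 := by
  unfold reluDeriv
  split_ifs <;> simp

theorem measurable_ntkIntegrand (i j : Fin n) : Measurable (ntkIntegrand x i j) := by
  unfold ntkIntegrand
  exact ((measurable_reluDeriv.comp (by fun_prop)).mul
    (measurable_reluDeriv.comp (by fun_prop))).const_mul _

theorem abs_ntkIntegrand_le (i j : Fin n) (w : Vec d) : |ntkIntegrand x i j w| ≤ ‖x i‖ * ‖x j‖ := by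
  obtain ⟨h1, h2⟩ := reluDeriv_mem_Icc (inner ℝ w (x i))
  obtain ⟨h3, h4⟩ := reluDeriv_mem_Icc (inner ℝ w (x j))
  rw [ntkIntegrand, abs_mul, abs_of_nonneg (mul_nonneg h1 h3)]
  exact (mul_le_of_le_one_right (abs_nonneg _) (mul_le_one₀ h2 h3 h4)).trans
    (abs_real_inner_le_norm _ _)

theorem memLp_ntkIntegrand (i j : Fin n) (p : ENNReal) :
    MemLp (ntkIntegrand x i j) p (stdGaussian (Vec d)) :=
  MemLp.of_bound (measurable_ntkIntegrand x i j).aestronglyMeasurable (‖x i‖ * ‖x j‖)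
    (Filter.Eventually.of_forall fun w => abs_ntkIntegrand_le x i j w)

theorem isHermitian_ntk : (ntk x).IsHermitian := by
  refine Matrix.IsHermitian.ext fun i j => ?_
  rw [star_trivial, ntk_apply, ntk_apply]
  congr 1
  ext w
  rw [ntkIntegrand, ntkIntegrand, real_inner_comm, mul_comm (reluDeriv _)]

theorem posSemidef_ntk : (ntk x).PosSemidef := by
  refine .of_dotProduct_mulVec_nonneg (isHermitian_ntk x) fun z => ?_
  have hint : ∀ i j, Integrable (fun w => z i * (ntkIntegrand x i j w * z j))
      (stdGaussian (Vec d)) := fun i j =>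
    ((memLp_one_iff_integrable.mp (memLp_ntkIntegrand x i j 1)).mul_const _).const_mul _
  have h1 : star z ⬝ᵥ (ntk x).mulVec z =
      ∫ w, ∑ i, ∑ j, z i * (ntkIntegrand x i j w * z j) ∂(stdGaussian (Vec d)) := by
    rw [integral_finsetSum _ fun i _ => integrable_finsetSum _ fun j _ => hint i j]
    simp only [star_trivial, dotProduct, Matrix.mulVec, Finset.mul_sum]
    refine Finset.sum_congr rfl fun i _ => ?_
    rw [integral_finsetSum _ fun j _ => hint i j]
    refine Finset.sum_congr rfl fun j _ => ?_
    rw [integral_const_mul, integral_mul_const, ntk_apply]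
  rw [h1]
  refine integral_nonneg fun w => ?_
  have h2 : ∑ i, ∑ j, z i * (ntkIntegrand x i j w * z j) =
      ‖∑ i, (z i * reluDeriv (inner ℝ w (x i))) • x i‖ ^ 2 := by
    rw [← real_inner_self_eq_norm_sq, sum_inner]
    refine Finset.sum_congr rfl fun i _ => ?_
    rw [inner_sum]
    refine Finset.sum_congr rfl fun j _ => ?_
    rw [real_inner_smul_left, real_inner_smul_right, ntkIntegrand]
    ring
  simp only [Pi.zero_apply, h2]
  positivity

theorem lambdaZero_nonneg : 0 ≤ lambdaZero x := by
  refine Real.sInf_nonneg fun μ hμ => ?_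
  exact (Matrix.posSemidef_iff_isHermitian_and_spectrum_nonneg.mp (posSemidef_ntk x)).2 hμ

theorem lambdaZero_le_sq {K : ℝ} (hx : ∀ i, ‖x i‖ ≤ K) (hn : 0 < n) : lambdaZero x ≤ K ^ 2 := by
  have h1 := (isHermitian_ntk x).sInf_spectrum_mul_norm_sq_le (EuclideanSpace.single ⟨0, hn⟩ 1)
  have h2 : ntk x ⟨0, hn⟩ ⟨0, hn⟩ ≤ K ^ 2 := by
    rw [ntk_apply]
    refine (le_abs_self _).trans ?_
    have h3 := norm_integral_le_of_norm_le_const (μ := stdGaussian (Vec d)) (C := K ^ 2)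
      (f := ntkIntegrand x ⟨0, hn⟩ ⟨0, hn⟩) (Filter.Eventually.of_forall fun w => ?_)
    · rwa [probReal_univ, mul_one] at h3
    · refine (abs_ntkIntegrand_le x _ _ w).trans ?_
      rw [pow_two]
      exact mul_self_le_mul_self (norm_nonneg _) (hx _)
  refine le_trans ?_ h2
  simpa [lambdaZero] using h1

/-- The step-size condition bounds the coefficient of the gradient by `2`. -/
theorem sqrt_mul_step_le_one (hpos : 0 < lambdaZero x) {s : ℝ}
    (hs : s ≤ 2 / lambdaM x) : √(lambdaZero x / 2 * s) ≤ 1 := by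
  have h1 : lambdaZero x ≤ sSup (spectrum ℝ (ntk x)) :=
    Real.sInf_le_sSup _ (ntk x).finite_real_spectrum.bddBelow
      (ntk x).finite_real_spectrum.bddAbove
  have h2 : lambdaZero x ≤ lambdaM x := by
    unfold lambdaM
    linarith
  rw [Real.sqrt_le_one]
  have h3 : lambdaZero x / 2 * s ≤ lambdaZero x / 2 * (2 / lambdaM x) := by gcongr
  refine h3.trans ?_
  rw [show lambdaZero x / 2 * (2 / lambdaM x) = lambdaZero x / lambdaM x by ring]
  exact div_le_one_of_le₀ h2 (hpos.le.trans h2)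

/-- The squared Frobenius distance between `ntk x` and its empirical version with neurons `w`. -/
noncomputable def ntkError {m : ℕ} (w : Fin m → Vec d) : ℝ :=
  ∑ i, ∑ j, (∑ r, 1 / (m : ℝ) * ntkIntegrand x i j (w r) - ntk x i j) ^ 2

variable {x}

theorem gram_apply_of_sq_eq_one {m : ℕ} {a : Fin m → ℝ} (ha : ∀ r, a r ^ 2 = 1)
    (w : Fin m → Vec d) (i j : Fin n) :
    gram x a w i j = ∑ r, 1 / (m : ℝ) * ntkIntegrand x i j (w r) := by
  rw [gram, Matrix.of_apply]
  refine Finset.sum_congr rfl fun r _ => ?_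
  have hm : (1 / √(m : ℝ)) ^ 2 = 1 / m := by
    rw [div_pow, Real.sq_sqrt (Nat.cast_nonneg m), one_pow]
  rw [outputGrad, outputGrad, real_inner_smul_left, real_inner_smul_right, ntkIntegrand, ← hm]
  linear_combination ((1 / √(m : ℝ)) ^ 2 * reluDeriv (inner ℝ (w r) (x i)) *
    reluDeriv (inner ℝ (w r) (x j)) * inner ℝ (x i) (x j)) * ha r

theorem lambdaZero_mul_norm_sq_le_gram {m : ℕ} {a : Fin m → ℝ} (ha : ∀ r, a r ^ 2 = 1)
    {w : Fin m → Vec d} (hpos : 0 < lambdaZero x)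
    (hw : ntkError x w ≤ (lambdaZero x / 4) ^ 2) (z : EuclideanSpace ℝ (Fin n)) :
    3 / 4 * lambdaZero x * ‖z‖ ^ 2 ≤ z.ofLp ⬝ᵥ (gram x a w).mulVec z.ofLp := by
  have h1 := (isHermitian_ntk x).sInf_spectrum_mul_norm_sq_le z
  change lambdaZero x * ‖z‖ ^ 2 ≤ _ at h1
  set D : Fin n × Fin n → ℝ := fun p => gram x a w p.1 p.2 - ntk x p.1 p.2 with hD
  have h2 : z.ofLp ⬝ᵥ (gram x a w).mulVec z.ofLp - z.ofLp ⬝ᵥ (ntk x).mulVec z.ofLp =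
      ∑ p, D p * (z p.1 * z p.2) := by
    rw [Fintype.sum_prod_type]
    simp only [dotProduct, Matrix.mulVec, Finset.mul_sum, ← Finset.sum_sub_distrib, hD]
    refine Finset.sum_congr rfl fun i _ => Finset.sum_congr rfl fun j _ => ?_
    ring
  have h3 : ∑ p, D p ^ 2 ≤ (lambdaZero x / 4) ^ 2 := by
    refine le_of_eq_of_le ?_ hw
    rw [Fintype.sum_prod_type]
    simp only [hD, gram_apply_of_sq_eq_one ha]
    rfl
  have h4 : ∑ p : Fin n × Fin n, (z p.1 * z p.2) ^ 2 = (‖z‖ ^ 2) ^ 2 := by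
    rw [Fintype.sum_prod_type, PiLp.norm_sq_eq_of_L2, pow_two (∑ i, _), Finset.sum_mul_sum]
    refine Finset.sum_congr rfl fun i _ => Finset.sum_congr rfl fun j _ => ?_
    simp [mul_pow]
  have h5 : |∑ p, D p * (z p.1 * z p.2)| ≤ lambdaZero x / 4 * ‖z‖ ^ 2 := by
    refine abs_le_of_sq_le_sq ?_ (by positivity)
    refine (Finset.sum_mul_sq_le_sq_mul_sq _ _ _).trans ?_
    rw [h4, mul_pow]
    gcongr
  have h6 := (abs_le.mp h5).1
  linarith

end Kernel

/-! ### The random initialization -/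

theorem lintegral_sq_sum_sub_eq {ι : Type*} [Fintype ι] {Ω : ι → Type*}
    [∀ i, MeasurableSpace (Ω i)] {μ : ∀ i, Measure (Ω i)} [∀ i, IsProbabilityMeasure (μ i)]
    {X : ∀ i, Ω i → ℝ} (hX : ∀ i, MemLp (X i) 2 (μ i)) :
    ∫⁻ ω, ENNReal.ofReal ((∑ i, X i (ω i) - ∑ i, ∫ z, X i z ∂(μ i)) ^ 2) ∂(Measure.pi μ) =
      ENNReal.ofReal (∑ i, Var[X i; μ i]) := by
  have hL : ∀ i, MemLp (fun ω : ∀ i, Ω i => X i (ω i)) 2 (Measure.pi μ) := fun i =>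
    (hX i).comp_measurePreserving (measurePreserving_eval μ i)
  have hmean : ∫ ω, (∑ i, fun ω : ∀ i, Ω i => X i (ω i)) ω ∂(Measure.pi μ) =
      ∑ i, ∫ z, X i z ∂(μ i) := by
    simp only [Finset.sum_apply]
    rw [integral_finsetSum _ fun i _ => (hL i).integrable one_le_two]
    exact Finset.sum_congr rfl fun i _ => integral_comp_eval (hX i).1
  have hsum : MemLp (∑ i, fun ω : ∀ i, Ω i => X i (ω i)) 2 (Measure.pi μ) :=
    memLp_finsetSum' _ fun i _ => hL i
  rw [← variance_sum_pi hX, ofReal_variance hsum, evariance_eq_lintegral_ofReal, hmean]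
  simp only [Finset.sum_apply]

theorem measure_not_le_le_of_lintegral_le {Ω : Type*} [MeasurableSpace Ω] {μ : Measure Ω}
    {F : Ω → ℝ} (hF : Measurable F) {b t p : ℝ} (ht : 0 < t) (hp : 0 ≤ p)
    (hb : ∫⁻ ω, ENNReal.ofReal (F ω) ∂μ ≤ ENNReal.ofReal b) (hbt : b ≤ t * p) :
    μ {ω | ¬ F ω ≤ t} ≤ ENNReal.ofReal p := by
  have ht' : ENNReal.ofReal t ≠ 0 := by simpa using ht
  calc μ {ω | ¬ F ω ≤ t} ≤ μ {ω | ENNReal.ofReal t ≤ ENNReal.ofReal (F ω)} :=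
        measure_mono fun ω hω => ENNReal.ofReal_le_ofReal (not_le.mp hω).le
    _ ≤ (∫⁻ ω, ENNReal.ofReal (F ω) ∂μ) / ENNReal.ofReal t :=
        meas_ge_le_lintegral_div hF.ennreal_ofReal.aemeasurable ht' ENNReal.ofReal_ne_top
    _ ≤ ENNReal.ofReal p := by
        refine ENNReal.div_le_of_le_mul ?_
        rw [← ENNReal.ofReal_mul hp, mul_comm p]
        exact hb.trans (ENNReal.ofReal_le_ofReal hbt)

section Rademacher

instance isProbabilityMeasure_rademacher : IsProbabilityMeasure rademacher := by
  constructor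
  rw [rademacher]
  simp [ENNReal.inv_two_add_inv_two]

theorem ae_rademacher_sq_eq_one : ∀ᵐ z ∂rademacher, z ^ 2 = 1 := by
  rw [rademacher, ae_add_measure_iff]
  constructor <;> refine Measure.ae_smul_measure ?_ _ <;> simp [ae_dirac_eq]

theorem ae_rademacher_abs_le : ∀ᵐ z ∂rademacher, |z| ≤ 1 := by
  filter_upwards [ae_rademacher_sq_eq_one] with z hz
  exact (sq_le_one_iff_abs_le_one z).mp hz.le

theorem memLp_rademacher (b : ℝ) (p : ENNReal) : MemLp (fun z => b * z) p rademacher := by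
  refine MemLp.of_bound (by fun_prop) |b| ?_
  filter_upwards [ae_rademacher_abs_le] with z hz
  rw [norm_mul, Real.norm_eq_abs, Real.norm_eq_abs]
  exact mul_le_of_le_one_right (abs_nonneg b) hz

theorem integral_rademacher (b : ℝ) : ∫ z, b * z ∂rademacher = 0 := by
  rw [rademacher, integral_add_measure]
  · simp [integral_smul_measure]
  · exact (integrable_dirac (by simp)).smul_measure (by simp)
  · exact (integrable_dirac (by simp)).smul_measure (by simp)

theorem variance_rademacher_le (b : ℝ) : Var[fun z => b * z; rademacher] ≤ b ^ 2 := by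
  have h := variance_le_sq_of_bounded (μ := rademacher) (X := fun z => b * z) (a := -|b|)
    (b := |b|) ?_ (by fun_prop)
  · refine h.trans_eq ?_
    rw [← sq_abs b]
    ring
  · filter_upwards [ae_rademacher_abs_le] with z hz
    refine abs_le.mp ?_
    rw [abs_mul]
    exact mul_le_of_le_one_right (abs_nonneg b) hz

end Rademacher

section Gaussian

variable {d : ℕ}

theorem map_inner_stdGaussian (ξ : Vec d) :
    (stdGaussian (Vec d)).map (fun w => inner ℝ w ξ) = gaussianReal 0 (‖ξ‖ ^ 2).toNNReal := by
  have h := IsGaussian.map_eq_gaussianReal (μ := stdGaussian (Vec d)) (innerSL ℝ ξ)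
  rw [variance_dual_stdGaussian, integral_strongDual_stdGaussian, innerSL_apply_norm] at h
  rw [← h]
  congr 1
  ext w
  exact real_inner_comm _ _

theorem lintegral_inner_sq_stdGaussian (ξ : Vec d) :
    ∫⁻ w, ENNReal.ofReal ((inner ℝ w ξ : ℝ) ^ 2) ∂(stdGaussian (Vec d)) =
      ENNReal.ofReal (‖ξ‖ ^ 2) := by
  have h1 : MemLp (innerSL ℝ ξ) 2 (stdGaussian (Vec d)) :=
    IsGaussian.memLp_dual _ _ 2 (by simp)
  have h := evariance_eq_lintegral_ofReal (innerSL ℝ ξ) (stdGaussian (Vec d))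
  rw [← ofReal_variance h1, variance_dual_stdGaussian, integral_strongDual_stdGaussian,
    innerSL_apply_norm] at h
  rw [h]
  simp only [sub_zero, innerSL_apply_apply, real_inner_comm ξ]

theorem gaussianReal_Icc_le {σ R : ℝ} (hσ : 0 < σ) (hR : 0 ≤ R) :
    gaussianReal 0 (σ ^ 2).toNNReal (Icc (-(R * σ)) (R * σ)) ≤ ENNReal.ofReal R := by
  have hv : (σ ^ 2).toNNReal ≠ 0 := by
    rw [Ne, Real.toNNReal_eq_zero, not_le]
    positivity
  rw [gaussianReal_apply_eq_integral 0 hv]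
  refine ENNReal.ofReal_le_ofReal ?_
  have hpdf : ∀ z, ‖gaussianPDFReal 0 (σ ^ 2).toNNReal z‖ ≤ 1 / (2 * σ) := by
    intro z
    rw [Real.norm_eq_abs, abs_of_nonneg (gaussianPDFReal_nonneg _ _ _), gaussianPDFReal,
      Real.coe_toNNReal _ (sq_nonneg σ)]
    have h1 : 2 * σ ≤ √(2 * Real.pi * σ ^ 2) := by
      refine Real.le_sqrt_of_sq_le ?_
      nlinarith [Real.pi_gt_three, sq_nonneg σ]
    have h2 : Real.exp (-(z - 0) ^ 2 / (2 * σ ^ 2)) ≤ 1 := by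
      refine Real.exp_le_one_iff.mpr ?_
      rw [neg_div]
      exact neg_nonpos.mpr (by positivity)
    calc _ ≤ (√(2 * Real.pi * σ ^ 2))⁻¹ * 1 := by gcongr
      _ ≤ (2 * σ)⁻¹ * 1 := by gcongr
      _ = _ := by rw [mul_one, one_div]
  have h := norm_setIntegral_le_of_norm_le_const (μ := volume) (s := Icc (-(R * σ)) (R * σ))
    (f := gaussianPDFReal 0 (σ ^ 2).toNNReal) (C := 1 / (2 * σ)) (by simp) fun z _ => hpdf z
  refine (le_abs_self _).trans (h.trans_eq ?_)
  rw [Measure.real, Real.volume_Icc, ENNReal.toReal_ofReal (by nlinarith)]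
  field_simp
  ring

theorem stdGaussian_abs_inner_le {ξ : Vec d} (hξ : ξ ≠ 0) {R : ℝ} (hR : 0 ≤ R) :
    stdGaussian (Vec d) {w | |inner ℝ w ξ| ≤ R * ‖ξ‖} ≤ ENNReal.ofReal R := by
  refine le_of_eq_of_le ?_ (gaussianReal_Icc_le (norm_pos_iff.mpr hξ) hR)
  rw [← map_inner_stdGaussian, Measure.map_apply (by fun_prop) measurableSet_Icc]
  congr 1
  ext w
  exact abs_le (a := (inner ℝ w ξ : ℝ))

end Gaussian

section Initialization

variable {n d m : ℕ} {x : Fin n → Vec d} {y : Fin n → ℝ} {K : ℝ}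

theorem measurable_ntkError : Measurable (ntkError x (m := m)) := by
  unfold ntkError
  refine Finset.measurable_fun_sum _ fun i _ => Finset.measurable_fun_sum _ fun j _ => ?_
  refine ((Finset.measurable_fun_sum _ fun r _ => ?_).sub_const _).pow_const 2
  exact ((measurable_ntkIntegrand x i j).comp (measurable_pi_apply r)).const_mul _

theorem lintegral_ntkError_le (hx : ∀ i, ‖x i‖ ≤ K) (hm : 0 < m) :
    ∫⁻ w, ENNReal.ofReal (ntkError x w) ∂(Measure.pi fun _ : Fin m => stdGaussian (Vec d)) ≤
      ENNReal.ofReal (n ^ 2 * K ^ 4 / m) := by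
  have hm0 : (m : ℝ) ≠ 0 := by positivity
  have hentry : ∀ i j, ∫⁻ w, ENNReal.ofReal
      ((∑ r, 1 / (m : ℝ) * ntkIntegrand x i j (w r) - ntk x i j) ^ 2)
      ∂(Measure.pi fun _ : Fin m => stdGaussian (Vec d)) ≤ ENNReal.ofReal (K ^ 4 / m) := by
    intro i j
    have h := lintegral_sq_sum_sub_eq (μ := fun _ : Fin m => stdGaussian (Vec d))
      (X := fun _ w => 1 / (m : ℝ) * ntkIntegrand x i j w)
      fun _ => (memLp_ntkIntegrand x i j 2).const_mul _
    have hmean : ∑ _r : Fin m, ∫ w, 1 / (m : ℝ) * ntkIntegrand x i j w ∂(stdGaussian (Vec d)) =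
        ntk x i j := by
      rw [Finset.sum_const, Finset.card_univ, Fintype.card_fin, nsmul_eq_mul, integral_const_mul,
        ntk_apply]
      field_simp
    rw [hmean] at h
    rw [h]
    refine ENNReal.ofReal_le_ofReal ?_
    have hvar : Var[fun w => 1 / (m : ℝ) * ntkIntegrand x i j w; stdGaussian (Vec d)] ≤
        (1 / m) ^ 2 * K ^ 4 := by
      rw [variance_const_mul]
      gcongr
      refine (variance_le_sq_of_bounded (a := -(K ^ 2)) (b := K ^ 2)
        (Filter.Eventually.of_forall fun w => ?_)
        (measurable_ntkIntegrand x i j).aemeasurable).trans_eq (by ring)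
      refine abs_le.mp ((abs_ntkIntegrand_le x i j w).trans ?_)
      rw [pow_two]
      exact mul_le_mul (hx i) (hx j) (norm_nonneg _) ((norm_nonneg _).trans (hx i))
    refine (Finset.sum_le_sum fun _ _ => hvar).trans_eq ?_
    rw [Finset.sum_const, Finset.card_univ, Fintype.card_fin, nsmul_eq_mul]
    field_simp
  have hmeas : ∀ i j, Measurable fun w : Fin m → Vec d =>
      ENNReal.ofReal ((∑ r, 1 / (m : ℝ) * ntkIntegrand x i j (w r) - ntk x i j) ^ 2) := by
    intro i j
    refine (((Finset.measurable_fun_sum _ fun r _ => ?_).sub_const _).pow_const 2).ennreal_ofReal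
    exact ((measurable_ntkIntegrand x i j).comp (measurable_pi_apply r)).const_mul _
  have hsplit : ∀ w : Fin m → Vec d, ENNReal.ofReal (ntkError x w) = ∑ i, ∑ j,
      ENNReal.ofReal ((∑ r, 1 / (m : ℝ) * ntkIntegrand x i j (w r) - ntk x i j) ^ 2) := by
    intro w
    rw [ntkError, ENNReal.ofReal_sum_of_nonneg fun i _ => Finset.sum_nonneg fun j _ => sq_nonneg _]
    exact Finset.sum_congr rfl fun i _ =>
      ENNReal.ofReal_sum_of_nonneg fun j _ => sq_nonneg _
  simp only [hsplit]
  rw [lintegral_finsetSum _ fun i _ => Finset.measurable_fun_sum _ fun j _ => hmeas i j]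
  calc _ ≤ ∑ _i : Fin n, ∑ _j : Fin n, ENNReal.ofReal (K ^ 4 / m) := by
        refine Finset.sum_le_sum fun i _ => ?_
        rw [lintegral_finsetSum _ fun j _ => hmeas i j]
        exact Finset.sum_le_sum fun j _ => hentry i j
    _ = ENNReal.ofReal (n ^ 2 * K ^ 4 / m) := by
        simp only [Finset.sum_const, Finset.card_univ, Fintype.card_fin, nsmul_eq_mul]
        rw [← mul_assoc, ← ENNReal.ofReal_natCast, ← ENNReal.ofReal_mul (by positivity),
          ← ENNReal.ofReal_mul (by positivity)]
        congr 1
        ring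

theorem measurableSet_abs_inner_le (ξ : Vec d) (R : ℝ) :
    MeasurableSet {z : Vec d | |inner ℝ z ξ| ≤ R * ‖ξ‖} :=
  measurableSet_le (by fun_prop) measurable_const

theorem measurable_kinkMass (R : ℝ) : Measurable (kinkMass x R (m := m)) := by
  unfold kinkMass
  refine Finset.measurable_fun_sum _ fun i _ => Finset.measurable_fun_sum _ fun r _ => ?_
  exact (((measurable_const.indicator (measurableSet_abs_inner_le (x i) R)).comp
    (measurable_pi_apply r)).const_mul _).const_mul _

theorem lintegral_kinkMass_le (hx : ∀ i, ‖x i‖ ≤ K) (hm : 0 < m) {R : ℝ} (hR : 0 ≤ R) :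
    ∫⁻ w, ENNReal.ofReal (kinkMass x R w) ∂(Measure.pi fun _ : Fin m => stdGaussian (Vec d)) ≤
      ENNReal.ofReal (n * K ^ 2 * R) := by
  have hm0 : (m : ℝ) ≠ 0 := by positivity
  set A : Fin n → Set (Vec d) := fun i => {z : Vec d | |inner ℝ z (x i)| ≤ R * ‖x i‖} with hA
  have hAm : ∀ i, MeasurableSet (A i) := fun i => measurableSet_abs_inner_le (x i) R
  have hnn : ∀ (w : Fin m → Vec d) i r, 0 ≤ 1 / (m : ℝ) * (‖x i‖ ^ 2 *
      (A i).indicator (fun _ => (1 : ℝ)) (w r)) := fun w i r => by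
    have : 0 ≤ (A i).indicator (fun _ => (1 : ℝ)) (w r) :=
      indicator_nonneg (fun _ _ => zero_le_one) _
    positivity
  have hmeas : ∀ i r, Measurable fun w : Fin m → Vec d => ENNReal.ofReal (1 / (m : ℝ) *
      (‖x i‖ ^ 2 * (A i).indicator (fun _ => (1 : ℝ)) (w r))) := fun i r =>
    ((((measurable_const.indicator (hAm i)).comp
      (measurable_pi_apply r)).const_mul _).const_mul _).ennreal_ofReal
  have hterm : ∀ i r, ∫⁻ w : Fin m → Vec d, ENNReal.ofReal (1 / (m : ℝ) *
      (‖x i‖ ^ 2 * (A i).indicator (fun _ => (1 : ℝ)) (w r)))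
      ∂(Measure.pi fun _ : Fin m => stdGaussian (Vec d)) ≤ ENNReal.ofReal (K ^ 2 * R / m) := by
    intro i r
    rcases eq_or_ne (x i) 0 with h0 | h0
    · simp [h0]
    have e : ∀ w : Fin m → Vec d, ENNReal.ofReal (1 / (m : ℝ) *
        (‖x i‖ ^ 2 * (A i).indicator (fun _ => (1 : ℝ)) (w r))) =
        ENNReal.ofReal (‖x i‖ ^ 2 / m) * (A i).indicator (fun _ => 1) (Function.eval r w) := by
      intro w
      by_cases hw : w r ∈ A i
      · rw [indicator_of_mem hw, indicator_of_mem (by exact hw), mul_one, mul_one]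
        congr 1
        ring
      · rw [indicator_of_notMem hw, indicator_of_notMem (by exact hw)]
        simp
    have hind : Measurable ((A i).indicator fun _ => (1 : ENNReal)) :=
      measurable_const.indicator (hAm i)
    have hind' : Measurable fun w : Fin m → Vec d =>
        (A i).indicator (fun _ => (1 : ENNReal)) (Function.eval r w) :=
      hind.comp (measurable_pi_apply r)
    simp only [e]
    rw [lintegral_const_mul _ hind',
      (measurePreserving_eval (fun _ : Fin m => stdGaussian (Vec d)) r).lintegral_comp hind,
      ← Pi.one_def, lintegral_indicator_one (hAm i)]
    calc _ ≤ ENNReal.ofReal (‖x i‖ ^ 2 / m) * ENNReal.ofReal R := by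
          gcongr
          exact stdGaussian_abs_inner_le h0 hR
      _ = ENNReal.ofReal (‖x i‖ ^ 2 / m * R) := (ENNReal.ofReal_mul (by positivity)).symm
      _ ≤ _ := by
          refine ENNReal.ofReal_le_ofReal ?_
          have := pow_le_pow_left₀ (norm_nonneg _) (hx i) 2
          calc ‖x i‖ ^ 2 / m * R ≤ K ^ 2 / m * R := by gcongr
            _ = _ := by ring
  have hsplit : ∀ w : Fin m → Vec d, ENNReal.ofReal (kinkMass x R w) = ∑ i, ∑ r,
      ENNReal.ofReal (1 / (m : ℝ) * (‖x i‖ ^ 2 * (A i).indicator (fun _ => (1 : ℝ)) (w r))) := by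
    intro w
    rw [kinkMass, ENNReal.ofReal_sum_of_nonneg fun i _ => Finset.sum_nonneg fun r _ => hnn w i r]
    exact Finset.sum_congr rfl fun i _ => ENNReal.ofReal_sum_of_nonneg fun r _ => hnn w i r
  simp only [hsplit]
  rw [lintegral_finsetSum _ fun i _ => Finset.measurable_fun_sum _ fun r _ => hmeas i r]
  calc _ ≤ ∑ _i : Fin n, ∑ _r : Fin m, ENNReal.ofReal (K ^ 2 * R / m) := by
        refine Finset.sum_le_sum fun i _ => ?_
        rw [lintegral_finsetSum _ fun r _ => hmeas i r]
        exact Finset.sum_le_sum fun r _ => hterm i r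
    _ = ENNReal.ofReal (n * K ^ 2 * R) := by
        simp only [Finset.sum_const, Finset.card_univ, Fintype.card_fin, nsmul_eq_mul]
        rw [← mul_assoc, ← ENNReal.ofReal_natCast, ← ENNReal.ofReal_natCast,
          ← ENNReal.ofReal_mul (by positivity), ← ENNReal.ofReal_mul (by positivity)]
        congr 1
        field_simp

theorem measurable_network (ξ : Vec d) :
    Measurable fun p : (Fin m → Vec d) × (Fin m → ℝ) => network p.2 p.1 ξ := by
  unfold network
  refine (Finset.measurable_fun_sum _ fun r _ => ?_).const_mul _
  refine ((measurable_pi_apply r).comp measurable_snd).mul ?_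
  refine lipschitzWith_relu.continuous.measurable.comp ?_
  exact (Continuous.inner continuous_id continuous_const).measurable.comp
    ((measurable_pi_apply r).comp measurable_fst)

theorem measurable_residual_sq : Measurable fun p : (Fin m → Vec d) × (Fin m → ℝ) =>
    ∑ i, netResidual x y p.2 p.1 i ^ 2 :=
  Finset.measurable_fun_sum _ fun i _ => ((measurable_network (x i)).sub_const _).pow_const 2

theorem relu_sq_le (z : ℝ) : relu z ^ 2 ≤ z ^ 2 := by
  rcases le_total 0 z with h | h
  · rw [relu, max_eq_left h]
  · rw [relu, max_eq_right h, zero_pow two_ne_zero]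
    exact sq_nonneg z

/-- The output of the network at initialization has variance at most `‖ξ‖²`, since the output signs
are independent of the first layer and of each other. -/
theorem lintegral_network_sq_le (hm : 0 < m) (ξ : Vec d) :
    ∫⁻ p, ENNReal.ofReal (network p.2 p.1 ξ ^ 2) ∂(initLaw d m) ≤ ENNReal.ofReal (‖ξ‖ ^ 2) := by
  have hm0 : (m : ℝ) ≠ 0 := by positivity
  have hinner : ∀ w : Fin m → Vec d,
      ∫⁻ a, ENNReal.ofReal (network a w ξ ^ 2) ∂(Measure.pi fun _ : Fin m => rademacher) ≤
        ∑ r, ENNReal.ofReal (1 / m) * ENNReal.ofReal ((inner ℝ (w r) ξ : ℝ) ^ 2) := by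
    intro w
    have h := lintegral_sq_sum_sub_eq (μ := fun _ : Fin m => rademacher)
      (X := fun r z => (1 / √(m : ℝ) * relu (inner ℝ (w r) ξ)) * z) fun r => memLp_rademacher _ 2
    simp only [integral_rademacher, Finset.sum_const_zero, sub_zero] at h
    have e : ∀ a, network a w ξ = ∑ r, (1 / √(m : ℝ) * relu (inner ℝ (w r) ξ)) * a r := by
      intro a
      rw [network, Finset.mul_sum]
      refine Finset.sum_congr rfl fun r _ => ?_
      ring
    simp only [e]
    rw [h, ENNReal.ofReal_sum_of_nonneg fun r _ => variance_nonneg _ _]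
    refine Finset.sum_le_sum fun r _ => ?_
    rw [← ENNReal.ofReal_mul (by positivity)]
    refine ENNReal.ofReal_le_ofReal ((variance_rademacher_le _).trans ?_)
    rw [mul_pow, div_pow, Real.sq_sqrt (Nat.cast_nonneg m), one_pow]
    exact mul_le_mul_of_nonneg_left (relu_sq_le _) (by positivity)
  rw [initLaw, lintegral_prod _ ((measurable_network ξ).pow_const 2).ennreal_ofReal.aemeasurable]
  refine (lintegral_mono hinner).trans ?_
  have hsq : Measurable fun z : Vec d => ENNReal.ofReal ((inner ℝ z ξ : ℝ) ^ 2) := by fun_prop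
  have hsq' : ∀ r, Measurable fun w : Fin m → Vec d =>
      ENNReal.ofReal ((inner ℝ (w r) ξ : ℝ) ^ 2) := fun r => hsq.comp (measurable_pi_apply r)
  rw [lintegral_finsetSum _ fun r _ => (hsq' r).const_mul _]
  have hr : ∀ r : Fin m, ∫⁻ w : Fin m → Vec d,
      ENNReal.ofReal (1 / m) * ENNReal.ofReal ((inner ℝ (w r) ξ : ℝ) ^ 2)
      ∂(Measure.pi fun _ : Fin m => stdGaussian (Vec d)) = ENNReal.ofReal (‖ξ‖ ^ 2 / m) := by
    intro r
    rw [lintegral_const_mul _ (hsq' r),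
      ((measurePreserving_eval (fun _ : Fin m => stdGaussian (Vec d)) r).lintegral_comp hsq :),
      lintegral_inner_sq_stdGaussian, ← ENNReal.ofReal_mul (by positivity)]
    congr 1
    ring
  simp only [hr, Finset.sum_const, Finset.card_univ, Fintype.card_fin, nsmul_eq_mul]
  rw [← ENNReal.ofReal_natCast, ← ENNReal.ofReal_mul (by positivity)]
  refine ENNReal.ofReal_le_ofReal ?_
  field_simp
  rfl

instance isProbabilityMeasure_initLaw : IsProbabilityMeasure (initLaw d m) := by
  unfold initLaw
  infer_instance

theorem lintegral_residual_sq_le (hx : ∀ i, ‖x i‖ ≤ K) (hy : ∀ i, |y i| ≤ K) (hm : 0 < m) :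
    ∫⁻ p, ENNReal.ofReal (∑ i, netResidual x y p.2 p.1 i ^ 2) ∂(initLaw d m) ≤
      ENNReal.ofReal (4 * n * K ^ 2) := by
  have hterm : ∀ i, ∫⁻ p, ENNReal.ofReal (netResidual x y p.2 p.1 i ^ 2) ∂(initLaw d m) ≤
      ENNReal.ofReal (4 * K ^ 2) := by
    intro i
    have hle : ∀ p : (Fin m → Vec d) × (Fin m → ℝ), ENNReal.ofReal (netResidual x y p.2 p.1 i ^ 2) ≤
        ENNReal.ofReal 2 * ENNReal.ofReal (network p.2 p.1 (x i) ^ 2) +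
          ENNReal.ofReal (2 * K ^ 2) := by
      intro p
      rw [← ENNReal.ofReal_mul (by norm_num), ← ENNReal.ofReal_add (by positivity) (by positivity)]
      refine ENNReal.ofReal_le_ofReal ?_
      have h1 : y i ^ 2 ≤ K ^ 2 := by
        rw [← sq_abs]
        exact pow_le_pow_left₀ (abs_nonneg _) (hy i) 2
      rw [netResidual]
      nlinarith [sq_nonneg (network p.2 p.1 (x i) + y i)]
    refine (lintegral_mono hle).trans ?_
    rw [lintegral_add_right _ measurable_const, lintegral_const, measure_univ, mul_one,
      lintegral_const_mul _ ((measurable_network (x i)).pow_const 2).ennreal_ofReal]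
    calc _ ≤ ENNReal.ofReal 2 * ENNReal.ofReal (‖x i‖ ^ 2) + ENNReal.ofReal (2 * K ^ 2) := by
          gcongr
          exact lintegral_network_sq_le hm (x i)
      _ = ENNReal.ofReal (2 * ‖x i‖ ^ 2 + 2 * K ^ 2) := by
          rw [← ENNReal.ofReal_mul (by norm_num), ← ENNReal.ofReal_add (by positivity)
            (by positivity)]
      _ ≤ _ := by
          refine ENNReal.ofReal_le_ofReal ?_
          have := pow_le_pow_left₀ (norm_nonneg _) (hx i) 2
          linarith
  have hsplit : ∀ p : (Fin m → Vec d) × (Fin m → ℝ),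
      ENNReal.ofReal (∑ i, netResidual x y p.2 p.1 i ^ 2) =
        ∑ i, ENNReal.ofReal (netResidual x y p.2 p.1 i ^ 2) := fun p =>
    ENNReal.ofReal_sum_of_nonneg fun i _ => sq_nonneg _
  simp only [hsplit]
  have hmeas : ∀ i, Measurable fun p : (Fin m → Vec d) × (Fin m → ℝ) =>
      ENNReal.ofReal (netResidual x y p.2 p.1 i ^ 2) := fun i =>
    (((measurable_network (x i)).sub_const _).pow_const 2).ennreal_ofReal
  rw [lintegral_finsetSum _ fun i _ => hmeas i]
  refine (Finset.sum_le_sum fun i _ => hterm i).trans_eq ?_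
  rw [Finset.sum_const, Finset.card_univ, Fintype.card_fin, nsmul_eq_mul,
    ← ENNReal.ofReal_natCast, ← ENNReal.ofReal_mul (by positivity)]
  congr 1
  ring

theorem ae_initLaw_sq_eq_one : ∀ᵐ p ∂(initLaw d m), ∀ r, p.2 r ^ 2 = 1 := by
  rw [ae_all_iff]
  intro r
  have h1 : ∀ᵐ a ∂(Measure.pi fun _ : Fin m => rademacher), a r ^ 2 = 1 :=
    (Measure.quasiMeasurePreserving_eval (fun _ : Fin m => rademacher) r).ae
      ae_rademacher_sq_eq_one
  exact Measure.quasiMeasurePreserving_snd.ae h1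

end Initialization

/-! ### The convergence theorem -/

/-- Markov's inequality for the three quantities that control the training dynamics, with a third of
the failure probability for each. -/
theorem initLaw_good_event {n d m : ℕ} {x : Fin n → Vec d} {y : Fin n → ℝ} {K δ R t₁ t₂ t₃ : ℝ}
    (hx : ∀ i, ‖x i‖ ≤ K) (hy : ∀ i, |y i| ≤ K) (hm : 0 < m) (hR : 0 ≤ R) (hδ : 0 < δ)
    (ht₁ : 0 < t₁) (ht₂ : 0 < t₂) (ht₃ : 0 < t₃) (h₁ : n ^ 2 * K ^ 4 / m ≤ t₁ * (δ / 3))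
    (h₂ : n * K ^ 2 * R ≤ t₂ * (δ / 3)) (h₃ : 4 * n * K ^ 2 ≤ t₃ * (δ / 3)) :
    ∃ G : Set ((Fin m → Vec d) × (Fin m → ℝ)),
      MeasurableSet G ∧ ENNReal.ofReal (1 - δ) ≤ initLaw d m G ∧
      ∀ w a, (w, a) ∈ G → (∀ r, a r ^ 2 = 1) ∧ ntkError x w ≤ t₁ ∧ kinkMass x R w ≤ t₂ ∧
        ∑ i, netResidual x y a w i ^ 2 ≤ t₃ := by
  set Ω := (Fin m → Vec d) × (Fin m → ℝ)
  have hp : 0 ≤ δ / 3 := by positivity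
  have mfst : MeasurePreserving (Prod.fst : Ω → Fin m → Vec d) (initLaw d m)
      (Measure.pi fun _ => stdGaussian (Vec d)) := measurePreserving_fst
  have m₁ : Measurable fun p : Ω => ntkError x p.1 := measurable_ntkError.comp measurable_fst
  have m₂ : Measurable fun p : Ω => kinkMass x R p.1 := (measurable_kinkMass R).comp measurable_fst
  have m₃ : Measurable fun p : Ω => ∑ i, netResidual x y p.2 p.1 i ^ 2 := measurable_residual_sq
  have e₁ : ∫⁻ p : Ω, ENNReal.ofReal (ntkError x p.1) ∂(initLaw d m) ≤
      ENNReal.ofReal (n ^ 2 * K ^ 4 / m) :=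
    (mfst.lintegral_comp measurable_ntkError.ennreal_ofReal).trans_le (lintegral_ntkError_le hx hm)
  have e₂ : ∫⁻ p : Ω, ENNReal.ofReal (kinkMass x R p.1) ∂(initLaw d m) ≤
      ENNReal.ofReal (n * K ^ 2 * R) :=
    (mfst.lintegral_comp (measurable_kinkMass R).ennreal_ofReal).trans_le
      (lintegral_kinkMass_le hx hm hR)
  set G : Set Ω := {p | (∀ r, p.2 r ^ 2 = 1) ∧ ntkError x p.1 ≤ t₁ ∧ kinkMass x R p.1 ≤ t₂ ∧
    ∑ i, netResidual x y p.2 p.1 i ^ 2 ≤ t₃} with hG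
  have hGm : MeasurableSet G := by
    have m₀ : MeasurableSet {p : Ω | ∀ r, p.2 r ^ 2 = 1} := by
      rw [ofPred_forall]
      exact MeasurableSet.iInter fun r => measurableSet_eq_fun
        (((measurable_pi_apply r).comp measurable_snd).pow_const 2) measurable_const
    exact m₀.inter ((measurableSet_le m₁ measurable_const).inter
      ((measurableSet_le m₂ measurable_const).inter (measurableSet_le m₃ measurable_const)))
  refine ⟨G, hGm, ?_, fun w a h => h⟩
  have hsub : Gᶜ ⊆ {p : Ω | ¬ ∀ r, p.2 r ^ 2 = 1} ∪ {p : Ω | ¬ ntkError x p.1 ≤ t₁} ∪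
      {p : Ω | ¬ kinkMass x R p.1 ≤ t₂} ∪ {p : Ω | ¬ ∑ i, netResidual x y p.2 p.1 i ^ 2 ≤ t₃} := by
    intro p hpG
    by_contra hcon
    simp only [mem_union, mem_ofPred_eq, not_or, not_not] at hcon
    exact hpG ⟨hcon.1.1.1, hcon.1.1.2, hcon.1.2, hcon.2⟩
  have hcompl : initLaw d m Gᶜ ≤ ENNReal.ofReal δ := by
    calc initLaw d m Gᶜ ≤ 0 + ENNReal.ofReal (δ / 3) + ENNReal.ofReal (δ / 3) +
          ENNReal.ofReal (δ / 3) := by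
          refine (measure_mono hsub).trans ?_
          refine (measure_union_le _ _).trans (add_le_add ?_ ?_)
          · refine (measure_union_le _ _).trans (add_le_add ?_ ?_)
            · refine (measure_union_le _ _).trans (add_le_add ?_ ?_)
              · exact (ae_iff.mp ae_initLaw_sq_eq_one).le
              · exact measure_not_le_le_of_lintegral_le m₁ ht₁ hp e₁ h₁
            · exact measure_not_le_le_of_lintegral_le m₂ ht₂ hp e₂ h₂
          · exact measure_not_le_le_of_lintegral_le m₃ ht₃ hp (lintegral_residual_sq_le hx hy hm) h₃
      _ = ENNReal.ofReal δ := by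
          rw [zero_add, ← ENNReal.ofReal_add hp hp, ← ENNReal.ofReal_add (by positivity) hp]
          congr 1
          ring
  have hG1 : initLaw d m G = 1 - initLaw d m Gᶜ := by
    rw [← prob_compl_eq_one_sub hGm.compl, compl_compl]
  rw [hG1, ENNReal.ofReal_sub _ hδ.le, ENNReal.ofReal_one]
  exact tsub_le_tsub_left hcompl 1

theorem loss_eq_norm_sq {n d m : ℕ} (x : Fin n → Vec d) (y : Fin n → ℝ) (a : Fin m → ℝ)
    (w : Fin m → Vec d) :
    loss x y a w = 1 / 2 * ‖WithLp.toLp 2 (netResidual x y a w)‖ ^ 2 := by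
  rw [loss, PiLp.norm_sq_eq_of_L2]
  simp

theorem theorem1 (K : ℝ) :
    ∃ C : ℝ, 0 < C ∧
      ∀ (n d m : ℕ) (x : Fin n → Vec d) (y : Fin n → ℝ), 0 < n →
        (∀ i, ‖x i‖ ≤ K) → (∀ i, |y i| ≤ K) →
        ∀ δ : ℝ, 0 < δ → δ < 1 →
          C * (n : ℝ) ^ 6 ≤ (m : ℝ) * (δ ^ 3 * lambdaZero x ^ 4) →
          ∀ s : ℝ, 0 < s → s ≤ 2 / lambdaM x →
            ∃ G : Set ((Fin m → Vec d) × (Fin m → ℝ)),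
              MeasurableSet G ∧ ENNReal.ofReal (1 - δ) ≤ initLaw d m G ∧
              ∀ w₀ a, (w₀, a) ∈ G →
                ∀ w v θ, IsHeavyBallSolution x y a (lambdaZero x / 2) s w₀ w v θ →
                  ∀ t : ℝ, 0 ≤ t →
                    loss x y a (w t) ≤ 6 * pseudoLoss x y a w₀ / lambdaZero x *
                      Real.exp (-(2 - Real.sqrt 2) * Real.sqrt (lambdaZero x / 2) * t) := by
  refine ⟨2 * 10 ^ 8 * (K ^ 8 + 1), by positivity, ?_⟩
  intro n d m x y hn hx hy δ hδ hδ1 hwidth s _ hs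
  have hn1 : (1 : ℝ) ≤ n := by exact_mod_cast hn
  have hK : 0 ≤ K := (norm_nonneg _).trans (hx ⟨0, hn⟩)
  have hl0 := lambdaZero_nonneg x
  have hlK := lambdaZero_le_sq x hx hn
  set l := lambdaZero x with hl
  have hprod : 0 < (m : ℝ) * (δ ^ 3 * l ^ 4) := lt_of_lt_of_le (by positivity) hwidth
  have hlpos : 0 < l := by
    refine hl0.lt_of_ne fun h => ?_
    simp [← h] at hprod
  have hm : 0 < m := by
    refine Nat.pos_of_ne_zero fun h => ?_
    simp [h] at hprod
  have hmR : (0 : ℝ) < m := by exact_mod_cast hm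
  have hKpos : 0 < K := by
    refine hK.lt_of_ne fun h => ?_
    rw [← h] at hlK
    norm_num at hlK
    linarith
  have hwidth' : 2 * 10 ^ 8 * K ^ 8 * (n : ℝ) ^ 6 ≤ m * δ ^ 3 * l ^ 4 := by
    have : (0 : ℝ) ≤ 2 * 10 ^ 8 * (n : ℝ) ^ 6 := by positivity
    linarith
  -- The radius exceeds the bound on the displacement of `IsHeavyBallSolution.residual_decay_of_radius`
  -- when the squared initial residual is at most `12 n K² / δ`.
  set D := √(m * δ) with hD
  have hDpos : 0 < D := Real.sqrt_pos.mpr (by positivity)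
  have hD2 : D ^ 2 = m * δ := Real.sq_sqrt (by positivity)
  set R := 28 * K ^ 2 * n / D / l with hR
  have hRpos : 0 < R := by positivity
  have h₁ : (n : ℝ) ^ 2 * K ^ 4 / m ≤ (l / 4) ^ 2 * (δ / 3) := by
    rw [div_le_iff₀ hmR]
    have a1 : (n : ℝ) ^ 2 ≤ n ^ 6 := pow_le_pow_right₀ hn1 (by norm_num)
    have a2 : δ ^ 3 ≤ δ := by
      simpa using pow_le_pow_of_le_one hδ.le hδ1.le (show 1 ≤ 3 by norm_num)
    have a3 : l ^ 2 ≤ K ^ 4 := by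
      calc l ^ 2 ≤ (K ^ 2) ^ 2 := by gcongr
        _ = K ^ 4 := by ring
    have a4 : m * δ ^ 3 * l ^ 4 ≤ m * δ * l ^ 2 * K ^ 4 := by
      calc m * δ ^ 3 * l ^ 4 = m * δ ^ 3 * (l ^ 2 * l ^ 2) := by ring
        _ ≤ m * δ * (l ^ 2 * K ^ 4) := by gcongr
        _ = _ := by ring
    have a5 : 2 * 10 ^ 8 * K ^ 8 * (n : ℝ) ^ 2 ≤ 2 * 10 ^ 8 * K ^ 8 * (n : ℝ) ^ 6 := by gcongr
    have a6 : (2 * 10 ^ 8 * (n : ℝ) ^ 2 * K ^ 4) * K ^ 4 ≤ (m * δ * l ^ 2) * K ^ 4 := by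
      linarith
    have a7 := le_of_mul_le_mul_right a6 (by positivity)
    have a8 : 0 ≤ (n : ℝ) ^ 2 * K ^ 4 := by positivity
    linarith
  have h₂ : (n : ℝ) * K ^ 2 * R ≤ 3 / 400 * l * (δ / 3) := by
    have b1 : (n : ℝ) ^ 4 ≤ n ^ 6 := pow_le_pow_right₀ hn1 (by norm_num)
    have b2 : 11200 * K ^ 4 * (n : ℝ) ^ 2 ≤ l ^ 2 * δ * D := by
      refine le_of_sq_le_sq ?_ (by positivity)
      have b3 : 2 * 10 ^ 8 * K ^ 8 * (n : ℝ) ^ 4 ≤ 2 * 10 ^ 8 * K ^ 8 * (n : ℝ) ^ 6 := by gcongr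
      have b4 : (l ^ 2 * δ * D) ^ 2 = m * δ ^ 3 * l ^ 4 := by
        rw [mul_pow, hD2]
        ring
      have b5 : 0 ≤ K ^ 8 * (n : ℝ) ^ 4 := by positivity
      rw [b4]
      linarith
    have e : (n : ℝ) * K ^ 2 * R = 28 * K ^ 4 * n ^ 2 / (D * l) := by
      rw [hR]
      field_simp
    rw [e, div_le_iff₀ (by positivity)]
    linarith
  have h₃ : 4 * (n : ℝ) * K ^ 2 ≤ 12 * n * K ^ 2 / δ * (δ / 3) := by
    refine le_of_eq ?_
    field_simp
    norm_num
  obtain ⟨G, hGm, hGp, hG⟩ := initLaw_good_event hx hy hm hRpos.le hδ (by positivity)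
    (by positivity) (by positivity) h₁ h₂ h₃
  refine ⟨G, hGm, hGp, fun w₀ a hmem w v θ hsol t ht => ?_⟩
  obtain ⟨ha, hntk, hkink, hres⟩ := hG w₀ a hmem
  have hgram := lambdaZero_mul_norm_sq_le_gram ha hlpos hntk
  set N := ‖WithLp.toLp 2 (netResidual x y a w₀)‖ with hN
  have hN0 : 0 ≤ N := norm_nonneg _
  have hN2 : N ^ 2 ≤ 12 * n * K ^ 2 / δ := by
    rw [hN, PiLp.norm_sq_eq_of_L2]
    simpa using hres
  have hradius : 8 * (K * Real.sqrt n / Real.sqrt m) * N / l < R := by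
    rw [hR]
    refine div_lt_div_of_pos_right (lt_of_pow_lt_pow_left₀ 2 (by positivity) ?_) hlpos
    calc (8 * (K * Real.sqrt n / Real.sqrt m) * N) ^ 2 = 64 * (K ^ 2 * n / m) * N ^ 2 := by
          rw [mul_pow, mul_pow, div_pow, mul_pow, Real.sq_sqrt hmR.le,
            Real.sq_sqrt (Nat.cast_nonneg n)]
          norm_num
      _ ≤ 64 * (K ^ 2 * n / m) * (12 * n * K ^ 2 / δ) := by gcongr
      _ = 768 * (K ^ 4 * n ^ 2 / (m * δ)) := by
          field_simp
          norm_num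
      _ < 784 * (K ^ 4 * n ^ 2 / (m * δ)) := by
          have : 0 < K ^ 4 * (n : ℝ) ^ 2 / (m * δ) := by positivity
          linarith
      _ = (28 * K ^ 2 * n / D) ^ 2 := by
          rw [div_pow, hD2]
          ring
  have hdecay := hsol.residual_decay_of_radius hlpos (sqrt_mul_step_le_one x hlpos hs) hx hK ha
    hgram hkink hradius ht
  have hpseudo : 3 / 8 * l * N ^ 2 ≤ pseudoLoss x y a w₀ := by
    have := hgram (WithLp.toLp 2 (netResidual x y a w₀))
    rw [pseudoLoss]
    linarith
  rw [← hN] at hdecay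
  rw [loss_eq_norm_sq, show -(2 - √2) * √(l / 2) * t = -((2 - √2) * √(l / 2)) * t by ring]
  have hcoef : 5 / 8 * N ^ 2 ≤ 6 * pseudoLoss x y a w₀ / l := by
    rw [le_div_iff₀ hlpos]
    have : 0 ≤ l * N ^ 2 := by positivity
    linarith
  calc 1 / 2 * ‖WithLp.toLp 2 (netResidual x y a (w t))‖ ^ 2
      ≤ 5 / 8 * N ^ 2 * Real.exp (-((2 - √2) * √(l / 2)) * t) := by linarith
    _ ≤ _ := by gcongr
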